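/- **Setting.** Fix a half-integer $s\in\{\frac12,1,\frac32,\dots\}$, a number $P$ of particles with positions $x^{[1]},\dots,x^{[P]}\in\mathbb R^3$ and magnetic moments $M=(M^{[1]},\dots,M^{[P]})\in\mathbb R^P$, and an even real-valued Schwartz function $\phi\in\mathcal S(\mathbb R)$ (ultraviolet cutoff). *Photons.* Let $\mathfrak H=\{V\in L^2(\mathbb R^3,\mathbb C^3): k\cdot V(k)=0 \text{ for a.e. }k\}$, let $\mathcal H_{\rm ph}$ be the symmetric Fock space over $\mathfrak H$ with vacuum $\Psi_0$, let ${\rm d}\Gamma(M_\omega)$ be the second quantization of the multiplication by $\omega(k)=|k|$ (its inverse being taken on the orthogonal complement of $\Psi_0$), and let $\Phi_{\rm S}(V)=2^{-1/2}(a(V)+a^*(V))$ be the Segal field. For $m=1,2,3$ and $x\in\mathbb R^3$ let $$B_{m,x}(k)=\frac{i\,\phi(|k|)\,|k|^{1/2}}{(2\pi)^{3/2}}\,e^{-ik\cdot x}\,\frac{k\times e_m}{|k|}.$$ *Spins.* Let $\rho_s$ be the standard irreducible unitary representation of $SU(2)$ on $V_s=\mathbb C^{2s+1}$, let $(u_1,u_2,u_3)$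 be a basis of its Lie algebra with $[u_1,u_2]=2u_3$ and cyclically, and let $\sigma_j(s)=i\,d\rho_s(u_j)$. Let $\mathcal H_{\rm sp}=V_s^{\otimes P}$, and let $\sigma_j(s)^{[\lambda]}$ be $\sigma_j(s)$ acting in the $\lambda$-th factor. Put $$H_{\rm int}=\sum_{\lambda=1}^P\sum_{m=1}^3 M^{[\lambda]}\,\Phi_{\rm S}(B_{m,x^{[\lambda]}})\otimes\sigma_m(s)^{[\lambda]},\qquad EX=\Psi_0\otimes X,\qquad A_MX=-E^\star H_{\rm int}\big({\rm d}\Gamma(M_\omega)^{-1}\otimes I\big)H_{\rm int}EX .$$ *Product states.* Fix $X_0\in V_s$ with $|X_0|=1$ and $\sum_{j=1}^3\langle\sigma_j(s)X_0,X_0\rangle^2=1$. Let $\Omega=\{\rho_s(g)X_0: g\in SU(2)\}$ and, for $V\in\Omega$, let $\pi(V)=(\langle\sigma_1(s)V,V\rangle,\langle\sigma_2(s)V,V\rangle,\langle\sigma_3(s)V,V\rangle)\in\mathbb R^3$. *Classical field.* Let $\rho(x)=(2\pi)^{-3}\int_{\mathbb R^3}\phi(|k|)e^{ik\cdot x}\,dk$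 and, for $S=(S^{[1]},\dots,S^{[P]})\in(\mathbb R^3)^P$, let ${\bf j}^{\rm class}(x,S)=\sum_{\lambda}M^{[\lambda]}\,\nabla\rho(x-x^{[\lambda]})\times S^{[\lambda]}$. Let ${\bf B}^{\rm class}(\cdot,S)$ be the square-integrable $C^1$ vector field on $\mathbb R^3$ with $\nabla\cdot{\bf B}^{\rm class}=0$ and $\nabla\times{\bf B}^{\rm class}={\bf j}^{\rm class}(\cdot,S)$. **Theorem.** Let $X=V^{[1]}\otimes\cdots\otimes V^{[P]}$ with $V^{[\lambda]}\in\Omega$ for all $\lambda$, and let $S(X)=(\pi(V^{[1]}),\dots,\pi(V^{[P]}))$. Then $A_MX$ is well defined, the field ${\bf B}^{\rm class}(\cdot,S(X))$ exists and is unique, and $$\langle A_MX,X\rangle=-\frac12\int_{\mathbb R^3}|{\bf B}^{\rm class}(x,S(X))|^2\,dx-C(s)\,A_{11}(0)\sum_{\lambda=1}^P(M^{[\lambda]})^2,\qquad C(s)=2s(s+1)-\frac12,$$ where $$A_{jm}(x)=(2\pi)^{-3}\int_{\mathbb R^3}|\phi(|k|)|^2e^{-ik\cdot x}\,\frac{\delta_{jm}|k|^2-k_jk_m}{|k|^2}\,dk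 .$$ -/

import Mathlib

open MeasureTheory
open scoped SchwartzMap ENNReal Matrix

namespace SpinQED

noncomputable section

/-! ## The photon space -/

/-- Physical (or momentum) space with its Euclidean norm. -/
abbrev R3 : Type := EuclideanSpace ℝ (Fin 3)

/-- The cross product on Euclidean three-space. -/
def cross (a b : R3) : R3 := WithLp.toLp 2 (WithLp.ofLp a ⨯₃ WithLp.ofLp b)

/-- The standard basis vector `e_m`. -/
def e (m : Fin 3) : R3 := EuclideanSpace.single m 1

/-- The space `L²(ℝ³, ℂ³)`. -/
abbrev VecL2 : Type := Lp (EuclideanSpace ℂ (Fin 3)) 2 (volume : Measure R3)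

/-- The single photon space: the transverse fields `V ∈ L²(ℝ³, ℂ³)`, i.e. those with
`k · V(k) = 0` for almost every `k`. -/
def onePhoton : Submodule ℂ VecL2 where
  carrier := {V | ∀ᵐ k, ∑ a, ((k a : ℝ) : ℂ) * V k a = 0}
  zero_mem' := by
    filter_upwards [Lp.coeFn_zero (EuclideanSpace ℂ (Fin 3)) 2 (volume : Measure R3)] with k hk
    rw [hk]
    simp
  add_mem' := by
    intro V W hV hW
    filter_upwards [hV, hW, Lp.coeFn_add V W] with k h1 h2 h3
    rw [h3]
    simp [mul_add, Finset.sum_add_distrib, h1, h2]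
  smul_mem' := by
    intro c V hV
    filter_upwards [hV, Lp.coeFn_smul c V] with k h1 h2
    have : ∀ a, ((k a : ℝ) : ℂ) * (c * V k a) = c * (((k a : ℝ) : ℂ) * V k a) := fun a => by ring
    rw [h2]
    simp [this, ← Finset.mul_sum, h1]

/-- A momentum together with a vector index: `L²(ℝ³, ℂ³)` is `L²(ℝ³ × {0,1,2})`. -/
abbrev Mode : Type := R3 × Fin 3

/-- Lebesgue measure in the momentum, counting measure in the index. -/
def modeMeasure : Measure Mode := (volume : Measure R3).prod Measure.count

instance : SigmaFinite modeMeasure := by unfold modeMeasure; infer_instance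

/-- The `n`-fold Hilbert space tensor power of `L²(ℝ³, ℂ³)`, realised as the space of
square integrable functions of `n` momenta and `n` vector indices. -/
abbrev TensorL2 (n : ℕ) : Type := Lp ℂ 2 (Measure.pi fun _ : Fin n => modeMeasure)

/-- The `n`-photon space, the `n`-fold symmetric tensor power of the one photon space: the closed
linear span of the powers `V ⊗ ⋯ ⊗ V`, where `V` is a one photon state. -/
def photonSector (n : ℕ) : Submodule ℂ (TensorL2 n) :=
  (Submodule.span ℂ {f : TensorL2 n | ∃ V ∈ onePhoton,
    f =ᵐ[Measure.pi fun _ : Fin n => modeMeasure]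
      fun q => ∏ i, V (q i).1 (q i).2}).topologicalClosure

instance (n : ℕ) : CompleteSpace (photonSector n) :=
  (Submodule.isClosed_topologicalClosure _).completeSpace_coe

/-- The symmetric Fock space over the one photon space. -/
abbrev Fock : Type := lp (fun n : ℕ => photonSector n) 2

lemma memLp_one_zero :
    MemLp (fun _ => (1 : ℂ)) 2 (Measure.pi fun _ : Fin 0 => modeMeasure) := by
  rw [Measure.pi_of_empty]
  exact memLp_const 1

/-- The unit vector of the zero photon space (the constant function `1` of no variables). -/
def sectorOne : photonSector 0 :=
  ⟨memLp_one_zero.toLp, subset_closure (Submodule.subset_span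
    ⟨0, onePhoton.zero_mem, by simpa using memLp_one_zero.coeFn_toLp⟩)⟩

/-- The photon vacuum `Ψ₀`. -/
def vacuum : Fock := lp.single 2 0 sectorOne

/-! ## Operators on the Fock space -/

lemma memLp_uncurry (V : VecL2) : MemLp (fun q : Mode => V q.1 q.2) 2 modeMeasure := by
  have h := (Lp.memLp V).comp_fst (Measure.count : Measure (Fin 3))
  refine h.of_le ?_ (Filter.Eventually.of_forall fun q => PiLp.norm_apply_le _ _)
  have hm : Measurable fun p : EuclideanSpace ℂ (Fin 3) × Fin 3 => p.1 p.2 :=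
    measurable_from_prod_countable_left fun a =>
      (EuclideanSpace.proj (𝕜 := ℂ) a).continuous.measurable
  exact (hm.comp_aemeasurable (h.1.aemeasurable.prodMk
    measurable_snd.aemeasurable)).aestronglyMeasurable

lemma succMap (n : ℕ) : MeasurePreserving
    (fun q : Fin (n + 1) → Mode => (q 0, fun j : Fin n => q j.succ))
    (Measure.pi fun _ => modeMeasure)
    (modeMeasure.prod (Measure.pi fun _ => modeMeasure)) := by
  have h := measurePreserving_piFinSuccAbove (fun _ : Fin (n + 1) => modeMeasure) 0
  convert h using 2 with q
  refine Prod.ext rfl (funext fun j => ?_)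
  simp [MeasurableEquiv.piFinSuccAbove, Fin.insertNthEquiv, Fin.tail]

lemma tailMap (n : ℕ) : Measure.QuasiMeasurePreserving
    (fun (q : Fin (n + 1) → Mode) (j : Fin n) => q j.succ)
    (Measure.pi fun _ => modeMeasure) (Measure.pi fun _ => modeMeasure) :=
  Measure.quasiMeasurePreserving_snd.comp (succMap n).quasiMeasurePreserving

lemma eLpNorm_tensor {α β : Type*} [MeasurableSpace α] [MeasurableSpace β] {μ : Measure α}
    {ν : Measure β} [SFinite μ] [SFinite ν] {f : α → ℂ} {g : β → ℂ}
    (hf : AEStronglyMeasurable f μ) (hg : AEStronglyMeasurable g ν) :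
    eLpNorm (fun z : α × β => f z.1 * g z.2) 2 (μ.prod ν) = eLpNorm f 2 μ * eLpNorm g 2 ν := by
  have h2 : (2 : ℝ≥0∞) ≠ 0 := by norm_num
  have h3 : (2 : ℝ≥0∞) ≠ ∞ := by norm_num
  simp only [eLpNorm_eq_lintegral_rpow_enorm_toReal h2 h3, enorm_mul]
  rw [← ENNReal.mul_rpow_of_nonneg _ _ (by positivity), ← lintegral_prod_mul (by fun_prop)
    (by fun_prop)]
  congr 2
  ext z
  rw [ENNReal.mul_rpow_of_nonneg _ _ (by positivity)]

lemma tensor_aux {n : ℕ} {v : Mode → ℂ} (hv : MemLp v 2 modeMeasure) {f : (Fin n → Mode) → ℂ}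
    (hf : MemLp f 2 (Measure.pi fun _ => modeMeasure)) :
    MemLp (fun q : Fin (n + 1) → Mode => v (q 0) * f (fun j => q j.succ)) 2
        (Measure.pi fun _ => modeMeasure) ∧
      eLpNorm (fun q : Fin (n + 1) → Mode => v (q 0) * f (fun j => q j.succ)) 2
        (Measure.pi fun _ => modeMeasure) =
      eLpNorm v 2 modeMeasure * eLpNorm f 2 (Measure.pi fun _ => modeMeasure) := by
  have hm : AEStronglyMeasurable (fun z : Mode × (Fin n → Mode) => v z.1 * f z.2)
      (modeMeasure.prod (Measure.pi fun _ => modeMeasure)) :=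
    hv.1.comp_fst.mul hf.1.comp_snd
  have hn := eLpNorm_comp_measurePreserving (p := 2) hm (succMap n)
  rw [eLpNorm_tensor hv.1 hf.1] at hn
  refine ⟨⟨hm.comp_measurePreserving (succMap n), ?_⟩, hn⟩
  exact (hn.trans_lt (ENNReal.mul_lt_top hv.2 hf.2))

/-- The bounded map `f ↦ V ⊗ f`. -/
def tensorLeft (V : VecL2) (n : ℕ) : TensorL2 n →L[ℂ] TensorL2 (n + 1) :=
  LinearMap.mkContinuous
    { toFun := fun f => (tensor_aux (memLp_uncurry V) (Lp.memLp f)).1.toLp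
      map_add' := by
        intro f g
        ext1
        refine (MemLp.coeFn_toLp _).trans ?_
        filter_upwards [Lp.coeFn_add ((tensor_aux (memLp_uncurry V) (Lp.memLp f)).1.toLp)
            ((tensor_aux (memLp_uncurry V) (Lp.memLp g)).1.toLp),
          (tensor_aux (memLp_uncurry V) (Lp.memLp f)).1.coeFn_toLp,
          (tensor_aux (memLp_uncurry V) (Lp.memLp g)).1.coeFn_toLp,
          (tailMap n).ae (Lp.coeFn_add f g)] with q h1 h2 h3 h4
        rw [h1, Pi.add_apply, h2, h3, h4, Pi.add_apply, mul_add]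
      map_smul' := by
        intro c f
        ext1
        refine (MemLp.coeFn_toLp _).trans ?_
        filter_upwards [Lp.coeFn_smul c ((tensor_aux (memLp_uncurry V) (Lp.memLp f)).1.toLp),
          (tensor_aux (memLp_uncurry V) (Lp.memLp f)).1.coeFn_toLp,
          (tailMap n).ae (Lp.coeFn_smul c f)] with q h1 h2 h4
        rw [RingHom.id_apply, h1, Pi.smul_apply, h2, h4, Pi.smul_apply, smul_eq_mul, smul_eq_mul]
        ring }
    (eLpNorm (fun q : Mode => V q.1 q.2) 2 modeMeasure).toReal
    (by
      intro f
      change ‖(tensor_aux (memLp_uncurry V) (Lp.memLp f)).1.toLp‖ ≤ _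
      rw [Lp.norm_toLp, (tensor_aux (memLp_uncurry V) (Lp.memLp f)).2, ENNReal.toReal_mul,
        Lp.norm_def])

/-- Creation `a*(V) f = √(n+1) S (V ⊗ f)` from the `n`-photon to the `(n+1)`-photon space, where
the symmetrisation `S` is the orthogonal projection on the symmetric tensors. -/
def creation (V : onePhoton) (n : ℕ) : photonSector n →L[ℂ] photonSector (n + 1) :=
  ((Real.sqrt (n + 1) : ℝ) : ℂ) •
    ((photonSector (n + 1)).orthogonalProjectionOnto ∘L tensorLeft V n ∘L (photonSector n).subtypeL)

/-- Annihilation `a(V)` from the `(n+1)`-photon to the `n`-photon space, the adjoint of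
creation. -/
def annihilation (V : onePhoton) (n : ℕ) : photonSector (n + 1) →L[ℂ] photonSector n :=
  ContinuousLinearMap.adjoint (creation V n)

/-- The `n`-photon component of `2^{-1/2} (a(V) + a*(V)) f`. -/
def segalComponent (V : onePhoton) : (n : ℕ) → Fock →ₗ[ℂ] photonSector n
  | 0 =>
    { toFun := fun f => ((Real.sqrt 2 : ℝ) : ℂ)⁻¹ • annihilation V 0 (f 1)
      map_add' := by intro f g; simp
      map_smul' := by intro c f; simp [smul_comm c] }
  | n + 1 =>
    { toFun := fun f => ((Real.sqrt 2 : ℝ) : ℂ)⁻¹ •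
        (annihilation V (n + 1) (f (n + 2)) + creation V n (f n))
      map_add' := by intro f g; simp; abel
      map_smul' := by intro c f; simp [smul_comm c] }

/-- The Segal field operator `Φ_S(V) = 2^{-1/2} (a(V) + a*(V))`, a self-adjoint operator, given by
its graph: its domain consists of all states for which the right-hand side is again in the
Fock space. -/
def segalField (V : onePhoton) : Fock →ₗ.[ℂ] Fock :=
  Submodule.toLinearPMap
    { carrier := {p : Fock × Fock | ∀ n, p.2 n = segalComponent V n p.1}
      zero_mem' := by intro n; simp
      add_mem' := by intro p q hp hq n; simp [hp n, hq n]
      smul_mem' := by intro c p hp n; simp [hp n] }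

/-- The self-adjoint operator `dΓ(M_w)`, where `M_w` is the multiplication by the function `w` in
the one photon space: in the `n`-photon space it is the multiplication by
`w(k_1) + ⋯ + w(k_n)`, with the maximal domain. It is given by its graph. -/
def dGammaMul (w : R3 → ℝ) : Fock →ₗ.[ℂ] Fock :=
  Submodule.toLinearPMap
    { carrier := {p : Fock × Fock | ∀ n,
        ((p.2 n : TensorL2 n) : (Fin n → Mode) → ℂ)
          =ᵐ[Measure.pi fun _ => modeMeasure]
        fun q => ((∑ i, w (q i).1 : ℝ) : ℂ) * (p.1 n : TensorL2 n) q}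
      zero_mem' := by
        intro n
        filter_upwards [Lp.coeFn_zero ℂ 2 (Measure.pi fun _ : Fin n => modeMeasure)] with q h
        change (0 : TensorL2 n) q = _ * (0 : TensorL2 n) q
        rw [h]
        simp
      add_mem' := by
        intro p p' hp hp' n
        filter_upwards [hp n, hp' n, Lp.coeFn_add (p.1 n : TensorL2 n) (p'.1 n : TensorL2 n),
          Lp.coeFn_add (p.2 n : TensorL2 n) (p'.2 n : TensorL2 n)] with q h1 h2 h3 h4
        simp only [Prod.fst_add, Prod.snd_add, lp.coeFn_add, Pi.add_apply, Submodule.coe_add] at *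
        rw [h3, h4, h1, h2, mul_add]
      smul_mem' := by
        intro c p hp n
        filter_upwards [hp n, Lp.coeFn_smul c (p.1 n : TensorL2 n),
          Lp.coeFn_smul c (p.2 n : TensorL2 n)] with q h1 h3 h4
        simp only [Prod.smul_fst, Prod.smul_snd, lp.coeFn_smul, Pi.smul_apply,
          Submodule.coe_smul, smul_eq_mul] at *
        rw [h3, h4, h1]
        ring }

/-- The free photon Hamiltonian `H_ph = dΓ(M_ω)` with `ω(k) = |k|`. -/
def photonHamiltonian : Fock →ₗ.[ℂ] Fock := dGammaMul fun k => ‖k‖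

/-- The inverse of `dΓ(M_ω)`, on the orthogonal complement of the vacuum (which spans the kernel
of `dΓ(M_ω)`); its domain is the range of `dΓ(M_ω)`. -/
def photonHamiltonianInv : Fock →ₗ.[ℂ] Fock :=
  (photonHamiltonian.domRestrict (Submodule.span ℂ {vacuum})ᗮ).inverse

/-! ## The representation of `SU(2)` of spin `d/2` -/

/-- The space `V_s = ℂ^{2s+1}`, where `d = 2s`. -/
abbrev SpinSpace (d : ℕ) : Type := EuclideanSpace ℂ (Fin (d + 1))

/-- The standard irreducible representation `ρ_s` of `SU(2)` in `V_s`, where `d = 2s`. It is the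
`d`-th symmetric power of the defining representation: `g` acts on the homogeneous polynomials of
degree `d` in `z₁, z₂` by `z₁ ↦ g₁₁ z₁ + g₂₁ z₂` and `z₂ ↦ g₁₂ z₁ + g₂₂ z₂`, and this is its
matrix in the orthonormal basis `√(d choose j) z₁^{d-j} z₂^j`, for `0 ≤ j ≤ d`. (The polynomials
below are dehomogenised by `z₁ = 1`, `z₂ = T`.) The formula makes sense for all matrices `g`. -/
def spinRep (d : ℕ) (g : Matrix (Fin 2) (Fin 2) ℂ) : Matrix (Fin (d + 1)) (Fin (d + 1)) ℂ :=
  Matrix.of fun i j =>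
    ((Real.sqrt (d.choose j) / Real.sqrt (d.choose i) : ℝ) : ℂ) *
      ((Polynomial.C (g 0 0) + Polynomial.C (g 1 0) * Polynomial.X) ^ (d - (j : ℕ)) *
        (Polynomial.C (g 0 1) + Polynomial.C (g 1 1) * Polynomial.X) ^ (j : ℕ)).coeff i

/-- The Lie algebra of `SU(2)`: traceless anti-Hermitian matrices. -/
def su2 : Submodule ℝ (Matrix (Fin 2) (Fin 2) ℂ) where
  carrier := {u | uᴴ = -u ∧ u.trace = 0}
  zero_mem' := by simp
  add_mem' := by
    rintro u v ⟨h1, h2⟩ ⟨h3, h4⟩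
    refine ⟨?_, by simp [h2, h4]⟩
    rw [Matrix.conjTranspose_add, h1, h3, neg_add]
  smul_mem' := by
    rintro c u ⟨h1, h2⟩
    exact ⟨by simp [Matrix.conjTranspose_smul, h1], by simp [h2]⟩

/-- The derived representation `dρ_s(u) = d/dt ρ_s(exp(t u))` at `t = 0`. -/
def spinRepDeriv (d : ℕ) (u : su2) : Matrix (Fin (d + 1)) (Fin (d + 1)) ℂ :=
  Matrix.of fun i j =>
    deriv (fun t : ℝ => spinRep d (NormedSpace.exp (t • (u : Matrix (Fin 2) (Fin 2) ℂ))) i j) 0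

/-- The spin matrices `σ_j(s) = i dρ_s(u_j)`. -/
def sigma (d : ℕ) (u : Fin 3 → su2) (j : Fin 3) : Matrix (Fin (d + 1)) (Fin (d + 1)) ℂ :=
  Complex.I • spinRepDeriv d (u j)

/-- The vector `(⟨σ₁(s) X, X⟩, ⟨σ₂(s) X, X⟩, ⟨σ₃(s) X, X⟩)`; the entries are real, because the
matrices `σ_j(s)` are Hermitian. -/
def hopf (d : ℕ) (u : Fin 3 → su2) (X : SpinSpace d) : R3 :=
  WithLp.toLp 2 fun j => (inner ℂ (Matrix.toEuclideanLin (sigma d u j) X) X).re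

/-- The orbit `Ω` of `X₀` under `SU(2)`. -/
def orbit (d : ℕ) (X₀ : SpinSpace d) : Set (SpinSpace d) :=
  {X | ∃ g ∈ Matrix.specialUnitaryGroup (Fin 2) ℂ, X = Matrix.toEuclideanLin (spinRep d g) X₀}

/-! ## Spins and photons -/

/-- The index set of the product basis of `V_s^{⊗P}`. -/
abbrev Config (P d : ℕ) : Type := Fin P → Fin (d + 1)

/-- The spin space `H_sp = V_s^{⊗P}`, in coordinates with respect to the product basis. -/
abbrev SpinStates (P d : ℕ) : Type := EuclideanSpace ℂ (Config P d)

/-- The product state `V^{[1]} ⊗ ⋯ ⊗ V^{[P]}`. -/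
def productState {P d : ℕ} (V : Fin P → SpinSpace d) : SpinStates P d :=
  WithLp.toLp 2 fun α => ∏ l, V l (α l)

/-- The operator `A^{[l]} = I ⊗ ⋯ ⊗ A ⊗ ⋯ ⊗ I`, with `A` at the position `l`. -/
def siteOp {P d : ℕ} (l : Fin P) (A : Matrix (Fin (d + 1)) (Fin (d + 1)) ℂ) :
    Matrix (Config P d) (Config P d) ℂ :=
  Matrix.of fun α β => ∏ m, (if m = l then A else 1) (α m) (β m)

/-- The total space `H_ph ⊗ H_sp`. As `H_sp` has a finite orthonormal basis, it is the Hilbert sum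
of copies of the Fock space indexed by this basis. -/
abbrev TotalSpace (P d : ℕ) : Type := PiLp 2 fun _ : Config P d => Fock

/-- The operator `T ⊗ A` on `D(T) ⊗ ℂ^κ`, for an operator `T` in a Hilbert space `H` and a
matrix `A` with index set `κ`; here `H ⊗ ℂ^κ` is the sum of `κ` copies of `H`. -/
def tensorOp {κ H : Type*} [Fintype κ] [NormedAddCommGroup H] [InnerProductSpace ℂ H]
    (T : H →ₗ.[ℂ] H) (A : Matrix κ κ ℂ) :
    PiLp 2 (fun _ : κ => H) →ₗ.[ℂ] PiLp 2 (fun _ : κ => H) where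
  domain :=
    { carrier := {f | ∀ α, f α ∈ T.domain}
      zero_mem' := fun _ => T.domain.zero_mem
      add_mem' := fun hf hg α => T.domain.add_mem (hf α) (hg α)
      smul_mem' := fun c _ hf α => T.domain.smul_mem c (hf α) }
  toFun :=
    { toFun := fun f => WithLp.toLp 2 fun α => ∑ β, A α β • T ⟨f.1 β, f.2 β⟩
      map_add' := by
        intro f g
        refine PiLp.ext fun α => ?_
        change _ = (∑ β, A α β • T ⟨f.1 β, f.2 β⟩) + ∑ β, A α β • T ⟨g.1 β, g.2 β⟩
        rw [← Finset.sum_add_distrib]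
        refine Finset.sum_congr rfl fun β _ => ?_
        rw [← smul_add, ← LinearPMap.map_add]
        rfl
      map_smul' := by
        intro c f
        refine PiLp.ext fun α => ?_
        change _ = c • ∑ β, A α β • T ⟨f.1 β, f.2 β⟩
        rw [Finset.smul_sum]
        refine Finset.sum_congr rfl fun β _ => ?_
        rw [smul_comm c]
        congr 1
        rw [← LinearPMap.map_smul]
        rfl }

/-- The map `E X = Ψ₀ ⊗ X`. -/
def embed (P d : ℕ) : SpinStates P d →L[ℂ] TotalSpace P d :=
  LinearMap.toContinuousLinearMap
    { toFun := fun X => WithLp.toLp 2 fun α => X α • vacuum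
      map_add' := by intro X Y; refine PiLp.ext fun α => ?_; exact add_smul _ _ _
      map_smul' := by intro c X; refine PiLp.ext fun α => ?_; exact mul_smul _ _ _ }

/-- The composition of partially defined operators, on its natural domain
`{x ∈ D(f) | f x ∈ D(g)}`. -/
def pcomp {E F G : Type*} [AddCommGroup E] [Module ℂ E] [AddCommGroup F] [Module ℂ F]
    [AddCommGroup G] [Module ℂ G] (g : F →ₗ.[ℂ] G) (f : E →ₗ.[ℂ] F) : E →ₗ.[ℂ] G :=
  g.comp (f.domRestrict ((g.domain.comap f.toFun).map f.domain.subtype)) (by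
    rintro ⟨x, hx, hx'⟩
    obtain ⟨y, hy, rfl⟩ := hx
    exact hy)

/-! ## The interaction and the second order operator -/

/-- The function `B_{m,x}(k) = i φ(|k|) |k|^{1/2} (2π)^{-3/2} e^{-i k·x} (k × e_m)/|k|`. -/
def fieldFun (φ : 𝓢(ℝ, ℝ)) (m : Fin 3) (x k : R3) : EuclideanSpace ℂ (Fin 3) :=
  WithLp.toLp 2 fun a =>
    (Complex.I * ((φ ‖k‖ * ‖k‖ ^ (1 / 2 : ℝ) / (2 * Real.pi) ^ (3 / 2 : ℝ) : ℝ) : ℂ)) *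
      Complex.exp (-(Complex.I * ((inner ℝ k x : ℝ) : ℂ))) *
      ((cross k (e m) a / ‖k‖ : ℝ) : ℂ)

lemma abs_apply_le (k : R3) (a : Fin 3) : |k a| ≤ ‖k‖ := by
  simpa using PiLp.norm_apply_le k a

lemma abs_cross_le (k : R3) (m a : Fin 3) : |cross k (e m) a| ≤ ‖k‖ := by
  have h := abs_apply_le k
  fin_cases m <;> fin_cases a <;> simp [cross, e, cross_apply, h]

lemma measurable_cross (m a : Fin 3) : Measurable fun k : R3 => cross k (e m) a := by
  fin_cases a <;> simp [cross, cross_apply] <;> fun_prop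

lemma memLp_fieldFun (φ : 𝓢(ℝ, ℝ)) (m : Fin 3) (x : R3) :
    MemLp (fieldFun φ m x) 2 (volume : Measure R3) := by
  rw [memLp_piLp_iff]
  intro a
  obtain ⟨C, hC⟩ : ∃ C : ℝ, ∀ t : ℝ, (1 + |t|) ^ 3 * |φ t| ≤ C := by
    refine ⟨2 ^ 3 * (Finset.Iic (3, 0)).sup (fun m => SchwartzMap.seminorm ℝ m.1 m.2) φ,
      fun t => ?_⟩
    simpa using SchwartzMap.one_add_le_sup_seminorm_apply (𝕜 := ℝ) (m := (3, 0)) (k := 3)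
      (n := 0) le_rfl le_rfl φ t
  have hg : MemLp (fun k : R3 => C * (1 + ‖k‖) ^ (-2 : ℝ)) 2 volume := by
    refine MemLp.const_mul ?_ C
    rw [memLp_two_iff_integrable_sq (Measurable.aestronglyMeasurable (by fun_prop))]
    have h4 : Integrable (fun k : R3 => (1 + ‖k‖) ^ (-4 : ℝ)) volume :=
      integrable_one_add_norm (by norm_num)
    refine h4.congr (Filter.Eventually.of_forall fun k => ?_)
    have h0 : (0 : ℝ) ≤ 1 + ‖k‖ := by positivity
    simp only
    rw [← Real.rpow_natCast, ← Real.rpow_mul h0]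
    norm_num
  refine hg.of_le ?_ (Filter.Eventually.of_forall fun k => ?_)
  · have h1 := measurable_cross m a
    have h2 : Measurable fun k : R3 => φ ‖k‖ := (φ.continuous.comp continuous_norm).measurable
    refine Measurable.aestronglyMeasurable ?_
    simp only [fieldFun]
    fun_prop
  · have h0 : (0 : ℝ) < 1 + ‖k‖ := by positivity
    have hc : |cross k (e m) a / ‖k‖| ≤ 1 := by
      rw [abs_div, abs_norm]
      exact div_le_one_of_le₀ (abs_cross_le k m a) (norm_nonneg k)
    have hk : ‖k‖ ^ (1 / 2 : ℝ) ≤ 1 + ‖k‖ := by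
      calc ‖k‖ ^ (1 / 2 : ℝ) ≤ (1 + ‖k‖) ^ (1 / 2 : ℝ) :=
            Real.rpow_le_rpow (norm_nonneg k) (by linarith) (by norm_num)
        _ ≤ (1 + ‖k‖) ^ (1 : ℝ) :=
            Real.rpow_le_rpow_of_exponent_le (by linarith [norm_nonneg k]) (by norm_num)
        _ = 1 + ‖k‖ := Real.rpow_one _
    have hpi : (1 : ℝ) ≤ (2 * Real.pi) ^ (3 / 2 : ℝ) :=
      Real.one_le_rpow (by linarith [Real.two_le_pi]) (by norm_num)
    have hφ := hC ‖k‖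
    rw [abs_norm] at hφ
    have hC0 : 0 ≤ C := le_trans (by positivity) hφ
    have hr : (1 + ‖k‖) ^ (-2 : ℝ) = ((1 + ‖k‖) ^ 2)⁻¹ := by
      rw [Real.rpow_neg h0.le]; norm_num
    have hexp : ‖Complex.exp (-(Complex.I * ((inner ℝ k x : ℝ) : ℂ)))‖ = 1 := by
      have : -(Complex.I * ((inner ℝ k x : ℝ) : ℂ)) = ((-(inner ℝ k x) : ℝ) : ℂ) * Complex.I := by
        push_cast; ring
      rw [this, Complex.norm_exp_ofReal_mul_I]
    have h1 : |φ ‖k‖ * ‖k‖ ^ (1 / 2 : ℝ)| ≤ C * ((1 + ‖k‖) ^ 2)⁻¹ := by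
      rw [← div_eq_mul_inv, le_div_iff₀ (by positivity), abs_mul,
        abs_of_nonneg (Real.rpow_nonneg (norm_nonneg k) _)]
      calc |φ ‖k‖| * ‖k‖ ^ (1 / 2 : ℝ) * (1 + ‖k‖) ^ 2
          ≤ |φ ‖k‖| * (1 + ‖k‖) * (1 + ‖k‖) ^ 2 := by gcongr
        _ = (1 + ‖k‖) ^ 3 * |φ ‖k‖| := by ring
        _ ≤ C := hφ
    simp only [fieldFun, norm_mul, Complex.norm_I, one_mul, Complex.norm_real, hexp, mul_one,
      Real.norm_eq_abs]
    rw [abs_of_nonneg hC0, hr, abs_of_nonneg (by positivity : 0 ≤ ((1 + ‖k‖) ^ 2)⁻¹), abs_div,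
      abs_of_nonneg (by positivity : 0 ≤ (2 * Real.pi) ^ (3 / 2 : ℝ))]
    calc |φ ‖k‖ * ‖k‖ ^ (1 / 2 : ℝ)| / (2 * Real.pi) ^ (3 / 2 : ℝ) * |cross k (e m) a / ‖k‖|
        ≤ |φ ‖k‖ * ‖k‖ ^ (1 / 2 : ℝ)| * 1 := by
          gcongr
          exact div_le_self (abs_nonneg _) hpi
      _ ≤ C * ((1 + ‖k‖) ^ 2)⁻¹ := by rw [mul_one]; exact h1

/-- The one photon state `B_{m,x}`. -/
def fieldState (φ : 𝓢(ℝ, ℝ)) (m : Fin 3) (x : R3) : onePhoton :=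
  ⟨(memLp_fieldFun φ m x).toLp, by
    filter_upwards [(memLp_fieldFun φ m x).coeFn_toLp] with k hk
    rw [hk]
    fin_cases m <;> simp [fieldFun, cross, e, cross_apply, Fin.sum_univ_three] <;> ring⟩

/-- The interaction `H_int(M) = ∑_l ∑_m M^{[l]} Φ_S(B_{m,x^{[l]}}) ⊗ σ_m(s)^{[l]}`. -/
def interaction {P : ℕ} (d : ℕ) (u : Fin 3 → su2) (φ : 𝓢(ℝ, ℝ)) (x : Fin P → R3)
    (M : Fin P → ℝ) : TotalSpace P d →ₗ.[ℂ] TotalSpace P d :=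
  ∑ l, ∑ m, ((M l : ℝ) : ℂ) • tensorOp (segalField (fieldState φ m (x l))) (siteOp l (sigma d u m))

/-- The operator `A_M = -E* H_int (dΓ(M_ω)⁻¹ ⊗ I) H_int E` in `H_sp`, on its natural domain. -/
def secondOrderOp {P : ℕ} (d : ℕ) (u : Fin 3 → su2) (φ : 𝓢(ℝ, ℝ)) (x : Fin P → R3)
    (M : Fin P → ℝ) : SpinStates P d →ₗ.[ℂ] SpinStates P d :=
  -((ContinuousLinearMap.adjoint (embed P d)).toLinearMap.compPMap
    (pcomp (interaction d u φ x M)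
      (pcomp (tensorOp photonHamiltonianInv 1)
        (pcomp (interaction d u φ x M) ((embed P d).toLinearMap.toPMap ⊤)))))

/-- `A_{jm}(x) = (2π)^{-3} ∫ |φ(|k|)|² e^{-i k·x} (δ_{jm} |k|² - k_j k_m) / |k|² dk`. -/
def transverseCoeff (φ : 𝓢(ℝ, ℝ)) (j m : Fin 3) (x : R3) : ℂ :=
  (((2 * Real.pi) ^ 3 : ℝ) : ℂ)⁻¹ * ∫ k : R3,
    ((|φ ‖k‖| ^ 2 : ℝ) : ℂ) * Complex.exp (-(Complex.I * ((inner ℝ k x : ℝ) : ℂ))) *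
      ((((if j = m then ‖k‖ ^ 2 else 0) - k j * k m) / ‖k‖ ^ 2 : ℝ) : ℂ)

/-! ## Classical magnetostatics -/

/-- `ρ(x) = (2π)^{-3} ∫ φ(|k|) e^{i k·x} dk`, which is real, because `k ↦ φ(|k|)` is real and
even. -/
def rho (φ : 𝓢(ℝ, ℝ)) (x : R3) : ℝ :=
  ((((2 * Real.pi) ^ 3 : ℝ) : ℂ)⁻¹ * ∫ k : R3,
    ((φ ‖k‖ : ℝ) : ℂ) * Complex.exp (Complex.I * ((inner ℝ k x : ℝ) : ℂ))).re

/-- The classical current density `j(y, S) = ∑_l M^{[l]} ∇ρ(y - x^{[l]}) × S^{[l]}`. -/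
def current {P : ℕ} (φ : 𝓢(ℝ, ℝ)) (x : Fin P → R3) (M : Fin P → ℝ) (S : Fin P → R3)
    (y : R3) : R3 :=
  ∑ l, M l • cross (gradient (rho φ) (y - x l)) (S l)

/-- The partial derivative `∂_i B_a`. -/
def partialD (B : R3 → R3) (i a : Fin 3) (y : R3) : ℝ := (fderiv ℝ B y (e i)) a

/-- The divergence `∇ · B`. -/
def divergence (B : R3 → R3) (y : R3) : ℝ := ∑ i, partialD B i i y

/-- The curl `∇ × B`. -/
def curl (B : R3 → R3) (y : R3) : R3 :=
  !₂[partialD B 1 2 y - partialD B 2 1 y, partialD B 2 0 y - partialD B 0 2 y,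
    partialD B 0 1 y - partialD B 1 0 y]

/-- `B` is the magnetic field of the current density `j`: a continuously differentiable field of
finite energy which solves the Maxwell equations `∇ · B = 0`, `∇ × B = j`. -/
structure IsMagneticField (j B : R3 → R3) : Prop where
  contDiff : ContDiff ℝ 1 B
  memLp : MemLp B 2 volume
  divergence_eq : ∀ y, divergence B y = 0
  curl_eq : ∀ y, curl B y = j y

end

end SpinQED

/-!
The number `⟨A_M X, X⟩` is a second order perturbation energy, and the proof compares it with the
classical energy term by term, both being double sums over pairs of dipoles.

*The operator side.* The vector `H_int E X` has only a one photon component, a combination of the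
states `B_{m,x}`. In three dimensions `|k|⁻¹ B_{m,x}` is still square integrable, so
`dΓ(M_ω)⁻¹` can be applied; then `E* H_int` absorbs the photon again. The matrix elements of
`dΓ(M_ω)⁻¹` between the states `B_{j,x}` and `B_{m,y}` are the coefficients `A_{jm}(y - x)`, so
that `A_M` is everywhere defined and equal to
`-½ ∑ M^{[l]} M^{[l']} A_{jm}(x^{[l']} - x^{[l]}) σ_j^{[l]} σ_m^{[l']}`
(`mem_graph_secondOrderOp`). In a product state the expectation of `σ_j^{[l]} σ_m^{[l']}`, for
`l ≠ l'`, is the product `S_j^{[l]} S_m^{[l']}` of the components of the classical spins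
(`inner_siteOp_siteOp_of_ne`). For `l = l'` the coefficient `A_{jm}(0)` is a multiple of the
identity matrix, because the cutoff is radial (`transverseCoeff_zero`), so that only the Casimir
operator `∑ σ_j² = d(d+2) = 4s(s+1)` enters (`IsSpinTriple.casimir`), where the classical expression
would have `|S^{[l]}|² = 1` (`sum_hopf_sq`). The excess `½ (4s(s+1) - 1)` is `C(s)`.

*The classical side.* The field is written down in Fourier space, as the transverse part of the
magnetisation `∑ M^{[l]} φ(|k|) e^{-ik·x^{[l]}} S^{[l]}` (`dipoleField`). As the transverse
projection does not change the curl, it solves the Maxwell equations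
(`isMagneticField_dipoleField`), and the Plancherel theorem gives its energy as a double sum with
the coefficients `A_{jm}` (`integral_norm_sq_dipoleField`). Uniqueness is the statement that a
square integrable `C¹` field `D` without divergence and curl vanishes. As `D` is only `C¹`, an
argument by harmonicity would need distributions; instead, the vector field
`(D·y) D - ½ |D|² y`, whose divergence is `-½ |D|²`, is integrated against rescaled cutoffs
(`eq_zero_of_divergence_curl_eq_zero`).

The facts on the representation of spin `d/2` all come from its action on the coherent vectors
`powerVec d z`, on which `ρ(g)` acts as `z ↦ g z`, and which span the space
(`spinRep_mulVec_powerVec`, `matrix_eq_of_powerVec`). They reduce to identities for two by two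
matrices. Partially defined operators are evaluated through their graphs, without explicit
domains.
-/

namespace SpinQED

noncomputable section

/-! ### The representation of spin `d/2` and its derivative -/

/-- The coordinates of the polynomial `(z₀ + z₁ T)^d` in the basis `√(d choose j) T^j`, i.e. the
coherent vector `z^{⊗d}` of the symmetric power. -/
def powerVec (d : ℕ) (z : Fin 2 → ℂ) : Fin (d + 1) → ℂ := fun j =>
  ((Real.sqrt (d.choose j) : ℝ) : ℂ) * z 0 ^ (d - (j : ℕ)) * z 1 ^ (j : ℕ)

lemma sqrt_choose_ne_zero {d : ℕ} (j : Fin (d + 1)) :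
    ((Real.sqrt (d.choose j) : ℝ) : ℂ) ≠ 0 := by
  have : 0 < d.choose j := Nat.choose_pos (Nat.lt_succ_iff.mp j.2)
  exact_mod_cast (Real.sqrt_pos.mpr (by exact_mod_cast this)).ne'

/-- The binomial weights make the pairing of powers multiplicative; this is the reason for the
choice of the basis in `spinRep`. -/
lemma powerVec_dotProduct (d : ℕ) (z w : Fin 2 → ℂ) :
    powerVec d z ⬝ᵥ powerVec d w = (z ⬝ᵥ w) ^ d := by
  have h : (z ⬝ᵥ w) ^ d = (z 1 * w 1 + z 0 * w 0) ^ d := by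
    congr 1
    simp [dotProduct, Fin.sum_univ_two, add_comm]
  rw [h, add_pow, ← Fin.sum_univ_eq_sum_range
    (fun j => (z 1 * w 1) ^ j * (z 0 * w 0) ^ (d - j) * (d.choose j : ℂ)) (d + 1)]
  refine Finset.sum_congr rfl fun j _ => ?_
  have hs : ((Real.sqrt (d.choose j) : ℝ) : ℂ) * ((Real.sqrt (d.choose j) : ℝ) : ℂ)
      = (d.choose j : ℂ) := by
    rw [← Complex.ofReal_mul, Real.mul_self_sqrt (Nat.cast_nonneg _), Complex.ofReal_natCast]
  simp only [powerVec, mul_pow, ← hs]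
  ring

lemma eq_zero_of_powerVec_dotProduct {d : ℕ} {c : Fin (d + 1) → ℂ}
    (h : ∀ z, powerVec d z ⬝ᵥ c = 0) : c = 0 := by
  set p : Polynomial ℂ := ∑ j : Fin (d + 1),
    Polynomial.C (((Real.sqrt (d.choose j) : ℝ) : ℂ) * c j) * Polynomial.X ^ (j : ℕ) with hp
  have h0 : p = 0 := by
    refine Polynomial.funext fun t => ?_
    have ht := h ![1, t]
    rw [hp, Polynomial.eval_finsetSum, Polynomial.eval_zero, ← ht]
    refine Finset.sum_congr rfl fun j _ => ?_
    simp [powerVec]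
    ring
  funext j
  have hj : p.coeff j = ((Real.sqrt (d.choose j) : ℝ) : ℂ) * c j := by
    rw [hp, Polynomial.finsetSum_coeff, Finset.sum_eq_single j]
    · rw [Polynomial.coeff_C_mul_X_pow, if_pos rfl]
    · intro i _ hij
      rw [Polynomial.coeff_C_mul_X_pow, if_neg]
      exact fun e => hij (Fin.ext e.symm)
    · simp
  rw [h0, Polynomial.coeff_zero] at hj
  exact (mul_eq_zero.mp hj.symm).resolve_left (sqrt_choose_ne_zero j)

lemma vec_eq_of_powerVec {d : ℕ} {c c' : Fin (d + 1) → ℂ}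
    (h : ∀ z, powerVec d z ⬝ᵥ c = powerVec d z ⬝ᵥ c') : c = c' := by
  refine sub_eq_zero.mp (eq_zero_of_powerVec_dotProduct (d := d) fun z => ?_)
  rw [dotProduct_sub, h, sub_self]

/-- The powers span the space, so a matrix is determined by its values on them. All identities
between the matrices of the representation are reduced to two by two matrices in this way. -/
lemma matrix_eq_of_powerVec {d : ℕ} {N N' : Matrix (Fin (d + 1)) (Fin (d + 1)) ℂ}
    (h : ∀ z w, powerVec d z ⬝ᵥ N *ᵥ powerVec d w = powerVec d z ⬝ᵥ N' *ᵥ powerVec d w) :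
    N = N' := by
  have h1 : ∀ w, N *ᵥ powerVec d w = N' *ᵥ powerVec d w :=
    fun w => vec_eq_of_powerVec fun z => h z w
  ext i j
  have h2 : (fun k => N i k) = fun k => N' i k := by
    refine vec_eq_of_powerVec (d := d) fun w => ?_
    rw [dotProduct_comm, dotProduct_comm (powerVec d w)]
    exact congrFun (h1 w) i
  exact congrFun h2 j

/-- The value at `z` of the homogenisation, in degree `d`, of a product of `d` linear
polynomials. -/
lemma sum_coeff_mul_homogeneous {d m n : ℕ} (hmn : m + n = d) (a b a' b' : ℂ) (z : Fin 2 → ℂ) :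
    ∑ i : Fin (d + 1), ((Polynomial.C a + Polynomial.C b * Polynomial.X) ^ m *
        (Polynomial.C a' + Polynomial.C b' * Polynomial.X) ^ n).coeff i *
          (z 0 ^ (d - (i : ℕ)) * z 1 ^ (i : ℕ)) =
      (a * z 0 + b * z 1) ^ m * (a' * z 0 + b' * z 1) ^ n := by
  set p := (Polynomial.C a + Polynomial.C b * Polynomial.X) ^ m *
        (Polynomial.C a' + Polynomial.C b' * Polynomial.X) ^ n with hp
  have hdeg : p.natDegree < d + 1 := by
    have h1 : ∀ a b : ℂ, (Polynomial.C a + Polynomial.C b * Polynomial.X).natDegree ≤ 1 := by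
      intro a b
      rw [add_comm]
      exact Polynomial.natDegree_linear_le
    have h2 := Polynomial.natDegree_mul_le_of_le (Polynomial.natDegree_pow_le_of_le m (h1 a b))
      (Polynomial.natDegree_pow_le_of_le n (h1 a' b'))
    rw [← hp] at h2
    omega
  -- For `z 0 ≠ 0` both sides are `z 0 ^ d` times a value of `p`; `z 0 = 0` follows by continuity.
  have key : ∀ z0 : ℂ, z0 ≠ 0 →
      ∑ i : Fin (d + 1), p.coeff i * (z0 ^ (d - (i : ℕ)) * z 1 ^ (i : ℕ)) =
      (a * z0 + b * z 1) ^ m * (a' * z0 + b' * z 1) ^ n := by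
    intro z0 h0
    have h3 : p.eval (z 1 / z0) = (a + b * (z 1 / z0)) ^ m * (a' + b' * (z 1 / z0)) ^ n := by
      simp [hp]
    rw [Polynomial.eval_eq_sum_range' hdeg, ← Fin.sum_univ_eq_sum_range
      (fun i => p.coeff i * (z 1 / z0) ^ i) (d + 1)] at h3
    have h4 : (a * z0 + b * z 1) ^ m * (a' * z0 + b' * z 1) ^ n =
        z0 ^ d * ((a + b * (z 1 / z0)) ^ m * (a' + b' * (z 1 / z0)) ^ n) := by
      have e1 : a * z0 + b * z 1 = z0 * (a + b * (z 1 / z0)) := by field_simp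
      have e2 : a' * z0 + b' * z 1 = z0 * (a' + b' * (z 1 / z0)) := by field_simp
      rw [e1, e2, mul_pow, mul_pow, ← hmn, pow_add]
      ring
    rw [h4, ← h3, Finset.mul_sum]
    refine Finset.sum_congr rfl fun i _ => ?_
    have hi : z0 ^ d = z0 ^ (d - (i : ℕ)) * z0 ^ (i : ℕ) := by
      rw [← pow_add, Nat.sub_add_cancel (Nat.lt_succ_iff.mp i.2)]
    rw [hi, div_pow]
    field_simp
  have hext := Continuous.ext_on (dense_compl_singleton (0 : ℂ))
    (f := fun z0 : ℂ => ∑ i : Fin (d + 1), p.coeff i * (z0 ^ (d - (i : ℕ)) * z 1 ^ (i : ℕ)))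
    (g := fun z0 : ℂ => (a * z0 + b * z 1) ^ m * (a' * z0 + b' * z 1) ^ n)
    (by fun_prop) (by fun_prop) (fun z0 h => key z0 h)
  exact congrFun hext (z 0)

lemma powerVec_vecMul_spinRep (d : ℕ) (g : Matrix (Fin 2) (Fin 2) ℂ) (z : Fin 2 → ℂ) :
    powerVec d z ᵥ* spinRep d g = powerVec d (z ᵥ* g) := by
  funext j
  have h := sum_coeff_mul_homogeneous (Nat.sub_add_cancel (Nat.lt_succ_iff.mp j.2))
    (g 0 0) (g 1 0) (g 0 1) (g 1 1) z
  have e0 : (z ᵥ* g) 0 = g 0 0 * z 0 + g 1 0 * z 1 := by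
    simp [Matrix.vecMul, dotProduct, Fin.sum_univ_two, mul_comm]
  have e1 : (z ᵥ* g) 1 = g 0 1 * z 0 + g 1 1 * z 1 := by
    simp [Matrix.vecMul, dotProduct, Fin.sum_univ_two, mul_comm]
  rw [powerVec, e0, e1, mul_assoc, ← h, Finset.mul_sum, Matrix.vecMul, dotProduct]
  refine Finset.sum_congr rfl fun i _ => ?_
  have hi := sqrt_choose_ne_zero i
  simp only [powerVec, spinRep, Matrix.of_apply, Complex.ofReal_div]
  field_simp

lemma spinRep_mulVec_powerVec (d : ℕ) (g : Matrix (Fin 2) (Fin 2) ℂ) (w : Fin 2 → ℂ) :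
    spinRep d g *ᵥ powerVec d w = powerVec d (g *ᵥ w) := by
  refine vec_eq_of_powerVec fun z => ?_
  rw [Matrix.dotProduct_mulVec, powerVec_vecMul_spinRep, powerVec_dotProduct, powerVec_dotProduct,
    Matrix.dotProduct_mulVec]

lemma powerVec_spinRep (d : ℕ) (g : Matrix (Fin 2) (Fin 2) ℂ) (z w : Fin 2 → ℂ) :
    powerVec d z ⬝ᵥ spinRep d g *ᵥ powerVec d w = (z ⬝ᵥ g *ᵥ w) ^ d := by
  rw [spinRep_mulVec_powerVec, powerVec_dotProduct]

lemma spinRep_mul (d : ℕ) (g h : Matrix (Fin 2) (Fin 2) ℂ) :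
    spinRep d (g * h) = spinRep d g * spinRep d h := by
  refine matrix_eq_of_powerVec fun z w => ?_
  rw [← Matrix.mulVec_mulVec, spinRep_mulVec_powerVec, spinRep_mulVec_powerVec,
    spinRep_mulVec_powerVec, Matrix.mulVec_mulVec]

lemma spinRep_one (d : ℕ) : spinRep d 1 = 1 := by
  refine matrix_eq_of_powerVec fun z w => ?_
  rw [spinRep_mulVec_powerVec, Matrix.one_mulVec, Matrix.one_mulVec]

lemma star_powerVec (d : ℕ) (z : Fin 2 → ℂ) : star (powerVec d z) = powerVec d (star z) := by
  funext j
  simp [powerVec]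

lemma dotProduct_conjTranspose_mulVec {n : Type*} [Fintype n] (N : Matrix n n ℂ) (z w : n → ℂ) :
    z ⬝ᵥ Nᴴ *ᵥ w = star (star w ⬝ᵥ N *ᵥ star z) := by
  rw [← Matrix.star_dotProduct_star, star_star, Matrix.star_mulVec, star_star,
    Matrix.dotProduct_mulVec]

lemma spinRep_conjTranspose (d : ℕ) (g : Matrix (Fin 2) (Fin 2) ℂ) :
    spinRep d gᴴ = (spinRep d g)ᴴ := by
  refine matrix_eq_of_powerVec fun z w => ?_
  rw [dotProduct_conjTranspose_mulVec, star_powerVec, star_powerVec, powerVec_spinRep,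
    powerVec_spinRep, star_pow, dotProduct_conjTranspose_mulVec]

/-- The derived representation `dρ_s(A)`, as in `spinRepDeriv`, but for all two by two matrices
`A`. This allows conjugates and adjoints of `A` without membership proofs. -/
def spinGen (d : ℕ) (A : Matrix (Fin 2) (Fin 2) ℂ) : Matrix (Fin (d + 1)) (Fin (d + 1)) ℂ :=
  Matrix.of fun i j => deriv (fun t : ℝ => spinRep d (NormedSpace.exp (t • A)) i j) 0

lemma hasDerivAt_exp_smul_apply (A : Matrix (Fin 2) (Fin 2) ℂ) (i j : Fin 2) :
    HasDerivAt (fun t : ℝ => (NormedSpace.exp (t • A)) i j) (A i j) 0 := by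
  let _ : NormedRing (Matrix (Fin 2) (Fin 2) ℂ) := Matrix.linftyOpNormedRing
  let _ : NormedAlgebra ℝ (Matrix (Fin 2) (Fin 2) ℂ) := Matrix.linftyOpNormedAlgebra
  have h := hasDerivAt_exp_smul_const (𝕂 := ℝ) A 0
  rw [zero_smul, NormedSpace.exp_zero, one_mul] at h
  have h1 := hasDerivAt_pi.mp h i
  exact hasDerivAt_pi.mp h1 j

lemma differentiableAt_coeff_mul {f g : ℝ → Polynomial ℂ} {x : ℝ}
    (hf : ∀ i, DifferentiableAt ℝ (fun t => (f t).coeff i) x)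
    (hg : ∀ i, DifferentiableAt ℝ (fun t => (g t).coeff i) x) (i : ℕ) :
    DifferentiableAt ℝ (fun t => (f t * g t).coeff i) x := by
  simp only [Polynomial.coeff_mul]
  exact DifferentiableAt.fun_sum fun p _ => (hf p.1).mul (hg p.2)

lemma differentiableAt_coeff_pow {f : ℝ → Polynomial ℂ} {x : ℝ}
    (hf : ∀ i, DifferentiableAt ℝ (fun t => (f t).coeff i) x) (n i : ℕ) :
    DifferentiableAt ℝ (fun t => (f t ^ n).coeff i) x := by
  induction n generalizing i with
  | zero => simp
  | succ n ih =>
    simp only [pow_succ]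
    exact differentiableAt_coeff_mul ih hf i

lemma differentiableAt_coeff_linear {a b : ℝ → ℂ} {x : ℝ} (ha : DifferentiableAt ℝ a x)
    (hb : DifferentiableAt ℝ b x) (i : ℕ) : DifferentiableAt ℝ
      (fun t => (Polynomial.C (a t) + Polynomial.C (b t) * Polynomial.X).coeff i) x := by
  rcases i with _ | _ | i
  · simpa using ha
  · simpa [Polynomial.coeff_C] using hb
  · simp

lemma hasDerivAt_spinRep_exp (d : ℕ) (A : Matrix (Fin 2) (Fin 2) ℂ) (i j : Fin (d + 1)) :
    HasDerivAt (fun t : ℝ => spinRep d (NormedSpace.exp (t • A)) i j) (spinGen d A i j) 0 := by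
  refine DifferentiableAt.hasDerivAt ?_
  have h := fun i j => (hasDerivAt_exp_smul_apply A i j).differentiableAt
  exact (differentiableAt_coeff_mul
    (differentiableAt_coeff_pow (differentiableAt_coeff_linear (h 0 0) (h 1 0)) _)
    (differentiableAt_coeff_pow (differentiableAt_coeff_linear (h 0 1) (h 1 1)) _) _).const_mul _

lemma hasDerivAt_dotProduct_mulVec {n : Type*} [Fintype n] {f : ℝ → Matrix n n ℂ}
    {f' : Matrix n n ℂ} {x : ℝ} (hf : ∀ i j, HasDerivAt (fun t => f t i j) (f' i j) x)
    (z w : n → ℂ) : HasDerivAt (fun t => z ⬝ᵥ f t *ᵥ w) (z ⬝ᵥ f' *ᵥ w) x := by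
  simp only [dotProduct, Matrix.mulVec]
  exact HasDerivAt.fun_sum fun i _ =>
    (HasDerivAt.fun_sum fun j _ => (hf i j).mul_const (w j)).const_mul (z i)

lemma powerVec_spinGen (d : ℕ) (A : Matrix (Fin 2) (Fin 2) ℂ) (z w : Fin 2 → ℂ) :
    powerVec d z ⬝ᵥ spinGen d A *ᵥ powerVec d w =
      d * (z ⬝ᵥ w) ^ (d - 1) * (z ⬝ᵥ A *ᵥ w) := by
  have h1 := hasDerivAt_dotProduct_mulVec (hasDerivAt_spinRep_exp d A) (powerVec d z)
    (powerVec d w)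
  simp only [powerVec_spinRep] at h1
  have h2 := (hasDerivAt_dotProduct_mulVec (hasDerivAt_exp_smul_apply A) z w).fun_pow d
  rw [h1.unique h2]
  simp

/-- Differentiation of `⟨z dρ(A), ρ(exp(tB)) w⟩ = d ⟨z, exp(tB) w⟩^{d-1} ⟨z A, exp(tB) w⟩`. -/
lemma powerVec_spinGen_mul (d : ℕ) (A B : Matrix (Fin 2) (Fin 2) ℂ) (z w : Fin 2 → ℂ) :
    powerVec d z ⬝ᵥ (spinGen d A * spinGen d B) *ᵥ powerVec d w =
      d * (z ⬝ᵥ w) ^ (d - 1) * (z ⬝ᵥ (A * B) *ᵥ w) +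
        d * (d - 1 : ℕ) * (z ⬝ᵥ w) ^ (d - 2) * (z ⬝ᵥ A *ᵥ w) * (z ⬝ᵥ B *ᵥ w) := by
  have h1 := hasDerivAt_dotProduct_mulVec (hasDerivAt_spinRep_exp d B)
    (powerVec d z ᵥ* spinGen d A) (powerVec d w)
  have e : ∀ g : Matrix (Fin 2) (Fin 2) ℂ,
      (powerVec d z ᵥ* spinGen d A) ⬝ᵥ spinRep d g *ᵥ powerVec d w =
        d * (z ⬝ᵥ g *ᵥ w) ^ (d - 1) * ((z ᵥ* A) ⬝ᵥ g *ᵥ w) := by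
    intro g
    rw [spinRep_mulVec_powerVec, ← Matrix.dotProduct_mulVec, powerVec_spinGen,
      ← Matrix.dotProduct_mulVec]
  simp only [e] at h1
  have h2 := (((hasDerivAt_dotProduct_mulVec (hasDerivAt_exp_smul_apply B) z w).fun_pow
    (d - 1)).const_mul (d : ℂ)).mul
      (hasDerivAt_dotProduct_mulVec (hasDerivAt_exp_smul_apply B) (z ᵥ* A) w)
  have h3 := h1.unique h2
  rw [← Matrix.dotProduct_mulVec, Matrix.mulVec_mulVec] at h3
  rw [h3]
  simp only [zero_smul, NormedSpace.exp_zero, Matrix.one_mulVec, ← Matrix.dotProduct_mulVec,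
    Matrix.mulVec_mulVec, Nat.sub_sub]
  ring

lemma spinGen_add (d : ℕ) (A B : Matrix (Fin 2) (Fin 2) ℂ) :
    spinGen d (A + B) = spinGen d A + spinGen d B := by
  refine matrix_eq_of_powerVec fun z w => ?_
  simp only [Matrix.add_mulVec, dotProduct_add, powerVec_spinGen, mul_add]

lemma spinGen_smul (d : ℕ) (c : ℝ) (A : Matrix (Fin 2) (Fin 2) ℂ) :
    spinGen d (c • A) = c • spinGen d A := by
  refine matrix_eq_of_powerVec fun z w => ?_
  simp only [Matrix.smul_mulVec, dotProduct_smul, powerVec_spinGen, mul_smul_comm]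

lemma spinGen_conjTranspose (d : ℕ) (A : Matrix (Fin 2) (Fin 2) ℂ) :
    spinGen d Aᴴ = (spinGen d A)ᴴ := by
  refine matrix_eq_of_powerVec fun z w => ?_
  have e : star (star w ⬝ᵥ star z) = z ⬝ᵥ w := by rw [Matrix.star_dotProduct_star, star_star]
  rw [dotProduct_conjTranspose_mulVec, star_powerVec, star_powerVec, powerVec_spinGen,
    powerVec_spinGen, dotProduct_conjTranspose_mulVec, star_mul', star_mul', star_pow,
    star_natCast, e]

/-- Equivariance of the derived representation: `ρ(g) dρ(A) ρ(g⁻¹) = dρ(g A g⁻¹)`. -/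
lemma spinRep_mul_spinGen_mul (d : ℕ) {g h : Matrix (Fin 2) (Fin 2) ℂ} (hgh : g * h = 1)
    (A : Matrix (Fin 2) (Fin 2) ℂ) :
    spinRep d g * spinGen d A * spinRep d h = spinGen d (g * A * h) := by
  refine matrix_eq_of_powerVec fun z w => ?_
  rw [powerVec_spinGen, ← Matrix.mulVec_mulVec, spinRep_mulVec_powerVec, ← Matrix.mulVec_mulVec,
    Matrix.dotProduct_mulVec, powerVec_vecMul_spinRep, powerVec_spinGen,
    ← Matrix.dotProduct_mulVec, ← Matrix.dotProduct_mulVec, Matrix.mulVec_mulVec,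
    Matrix.mulVec_mulVec, Matrix.mulVec_mulVec, hgh, Matrix.one_mulVec, mul_assoc]

/-! ### Bases of `su(2)` and the Casimir operator -/

/-- The matrices `-i` times the Pauli matrices, with `[τ₀, τ₁] = 2 τ₂` and cyclically. -/
def pauliGen (p : Fin 3) : Matrix (Fin 2) (Fin 2) ℂ :=
  ![!![0, -Complex.I; -Complex.I, 0], !![0, -1; 1, 0], !![-Complex.I, 0; 0, Complex.I]] p

/-- The coordinates with respect to `pauliGen` of a traceless anti-Hermitian matrix (for other
matrices the values have no meaning). -/
def su2Coord (A : Matrix (Fin 2) (Fin 2) ℂ) : Fin 3 → ℝ := ![-(A 0 1).im, -(A 0 1).re, -(A 0 0).im]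

lemma sum_su2Coord_smul_pauliGen {A : Matrix (Fin 2) (Fin 2) ℂ} (hA : A ∈ su2) :
    ∑ p, su2Coord A p • pauliGen p = A := by
  obtain ⟨h1, h2⟩ := hA
  have h00 := congrFun (congrFun h1 0) 0
  have h01 := congrFun (congrFun h1 0) 1
  rw [Matrix.trace_fin_two] at h2
  simp only [Matrix.conjTranspose_apply, Matrix.neg_apply, Complex.ext_iff, Complex.star_def,
    Complex.conj_re, Complex.conj_im, Complex.neg_re, Complex.neg_im] at h00 h01
  simp only [Complex.ext_iff, Complex.add_re, Complex.add_im, Complex.zero_re,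
    Complex.zero_im] at h2
  ext i j
  fin_cases i <;> fin_cases j <;>
    simp [Fin.sum_univ_three, su2Coord, pauliGen, Complex.ext_iff] <;> (try constructor) <;>
    linarith

lemma su2Coord_lie {A B : Matrix (Fin 2) (Fin 2) ℂ} (hA : A ∈ su2) (hB : B ∈ su2) :
    su2Coord ⁅A, B⁆ = (2 : ℝ) • (su2Coord A ⨯₃ su2Coord B) := by
  rw [← sum_su2Coord_smul_pauliGen hA, ← sum_su2Coord_smul_pauliGen hB]
  funext p
  generalize su2Coord A = a
  generalize su2Coord B = b
  fin_cases p <;>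
    simp [Fin.sum_univ_three, su2Coord, pauliGen, cross_apply, Ring.lie_def] <;>
    ring

lemma su2Coord_smul (c : ℝ) (A : Matrix (Fin 2) (Fin 2) ℂ) :
    su2Coord (c • A) = c • su2Coord A := by
  funext p
  fin_cases p <;> simp [su2Coord]

/-- Three vectors which satisfy the cyclic cross product relations and are not all zero form an
orthonormal basis; the conclusion is the orthonormality of the columns of the matrix of these
vectors. -/
lemma orthonormal_of_cross_eq {a : Fin 3 → Fin 3 → ℝ} (h0 : a 0 ≠ 0)
    (h : ∀ j, a j ⨯₃ a (j + 1) = a (j + 2)) (p q : Fin 3) :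
    ∑ j, a j p * a j q = if p = q then 1 else 0 := by
  have hc : ∀ j, a j 1 * a (j + 1) 2 - a j 2 * a (j + 1) 1 = a (j + 2) 0 ∧
      a j 2 * a (j + 1) 0 - a j 0 * a (j + 1) 2 = a (j + 2) 1 ∧
      a j 0 * a (j + 1) 1 - a j 1 * a (j + 1) 0 = a (j + 2) 2 := by
    intro j
    have e := h j
    rw [cross_apply] at e
    exact ⟨congrFun e 0, congrFun e 1, congrFun e 2⟩
  obtain ⟨x0, x1, x2⟩ := hc 0
  obtain ⟨y0, y1, y2⟩ := hc 1
  obtain ⟨z0, z1, z2⟩ := hc 2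
  simp only [Fin.isValue, zero_add, show (1 : Fin 3) + 1 = 2 from rfl,
    show (1 : Fin 3) + 2 = 0 from rfl, show (2 : Fin 3) + 1 = 0 from rfl,
    show (2 : Fin 3) + 2 = 1 from rfl] at x0 x1 x2 y0 y1 y2 z0 z1 z2
  have d01 : a 0 0 * a 1 0 + a 0 1 * a 1 1 + a 0 2 * a 1 2 = 0 := by
    rw [← z0, ← z1, ← z2]; ring
  have d12 : a 1 0 * a 2 0 + a 1 1 * a 2 1 + a 1 2 * a 2 2 = 0 := by
    rw [← x0, ← x1, ← x2]; ring
  have d02 : a 0 0 * a 2 0 + a 0 1 * a 2 1 + a 0 2 * a 2 2 = 0 := by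
    rw [← x0, ← x1, ← x2]; ring
  have n1 : a 1 0 ^ 2 + a 1 1 ^ 2 + a 1 2 ^ 2 = a 0 0 ^ 2 + a 0 1 ^ 2 + a 0 2 ^ 2 := by
    linear_combination a 0 0 * y0 + a 0 1 * y1 + a 0 2 * y2 - a 1 0 * z0 - a 1 1 * z1 - a 1 2 * z2
  have n2 : a 2 0 ^ 2 + a 2 1 ^ 2 + a 2 2 ^ 2 = a 0 0 ^ 2 + a 0 1 ^ 2 + a 0 2 ^ 2 := by
    linear_combination a 0 0 * y0 + a 0 1 * y1 + a 0 2 * y2 - a 2 0 * x0 - a 2 1 * x1 - a 2 2 * x2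
  have n3 : (a 0 0 ^ 2 + a 0 1 ^ 2 + a 0 2 ^ 2) * (a 1 0 ^ 2 + a 1 1 ^ 2 + a 1 2 ^ 2) =
      a 2 0 ^ 2 + a 2 1 ^ 2 + a 2 2 ^ 2 +
        (a 0 0 * a 1 0 + a 0 1 * a 1 1 + a 0 2 * a 1 2) ^ 2 := by
    rw [← x0, ← x1, ← x2]; ring
  have n0 : a 0 0 ^ 2 + a 0 1 ^ 2 + a 0 2 ^ 2 = 1 := by
    rw [n1, n2, d01] at n3
    have hne : a 0 0 ^ 2 + a 0 1 ^ 2 + a 0 2 ^ 2 ≠ 0 := by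
      intro hz
      refine h0 (funext fun p => ?_)
      have s0 := sq_nonneg (a 0 0)
      have s1 := sq_nonneg (a 0 1)
      have s2 := sq_nonneg (a 0 2)
      refine (pow_eq_zero_iff two_ne_zero).mp (?_ : a 0 p ^ 2 = 0)
      fin_cases p <;> simp only [Fin.zero_eta, Fin.mk_one, Fin.reduceFinMk] <;> linarith
    refine mul_left_cancel₀ hne ?_
    linarith
  have hA : Matrix.of a * (Matrix.of a)ᵀ = 1 := by
    ext i j
    rw [Matrix.mul_apply, Fin.sum_univ_three]
    fin_cases i <;> fin_cases j <;> simp <;> linarith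
  have hB : ((Matrix.of a)ᵀ * Matrix.of a) p q = (1 : Matrix (Fin 3) (Fin 3) ℝ) p q := by
    rw [mul_eq_one_comm.mp hA]
  rw [Matrix.mul_apply, Matrix.one_apply] at hB
  simpa using hB

/-- Three elements of `su(2)`, not zero, with the commutation relations `[u₀, u₁] = 2 u₂` and
cyclically. Unlike a basis, such a triple can be conjugated without repackaging. -/
structure IsSpinTriple (u : Fin 3 → Matrix (Fin 2) (Fin 2) ℂ) : Prop where
  mem : ∀ j, u j ∈ su2
  ne_zero : u 0 ≠ 0
  lie_eq : ∀ j, ⁅u j, u (j + 1)⁆ = (2 : ℝ) • u (j + 2)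

lemma IsSpinTriple.orthonormal {u : Fin 3 → Matrix (Fin 2) (Fin 2) ℂ} (hu : IsSpinTriple u)
    (p q : Fin 3) : ∑ j, su2Coord (u j) p * su2Coord (u j) q = if p = q then 1 else 0 := by
  refine orthonormal_of_cross_eq (a := fun j => su2Coord (u j)) ?_ ?_ p q
  · intro h
    apply hu.ne_zero
    have h' : su2Coord (u 0) = 0 := h
    rw [← sum_su2Coord_smul_pauliGen (hu.mem 0), h']
    simp
  · intro j
    have h := su2Coord_lie (hu.mem j) (hu.mem (j + 1))
    rw [hu.lie_eq, su2Coord_smul] at h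
    exact (smul_right_injective _ (two_ne_zero' ℝ) h).symm

/-- An orthogonal change of coordinates leads from `pauliGen` to `u`, so that `∑ⱼ uⱼ ⊗ uⱼ` does not
depend on the triple. -/
lemma IsSpinTriple.sum_bilin {u : Fin 3 → Matrix (Fin 2) (Fin 2) ℂ} (hu : IsSpinTriple u)
    {W : Type*} [AddCommGroup W] [Module ℝ W]
    (β : Matrix (Fin 2) (Fin 2) ℂ →ₗ[ℝ] Matrix (Fin 2) (Fin 2) ℂ →ₗ[ℝ] W) :
    ∑ j, β (u j) (u j) = ∑ p, β (pauliGen p) (pauliGen p) := by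
  have h : ∀ j, β (u j) (u j) = ∑ p, ∑ q, (su2Coord (u j) p * su2Coord (u j) q) •
      β (pauliGen p) (pauliGen q) := by
    intro j
    conv_lhs => rw [← sum_su2Coord_smul_pauliGen (hu.mem j)]
    simp only [map_sum, map_smul, LinearMap.sum_apply, LinearMap.smul_apply, Finset.smul_sum,
      smul_smul]
    rw [Finset.sum_comm]
    simp only [mul_comm]
  simp only [h]
  rw [Finset.sum_comm]
  refine Finset.sum_congr rfl fun p _ => ?_
  rw [Finset.sum_comm]
  simp only [← Finset.sum_smul, hu.orthonormal, ite_smul, one_smul, zero_smul, Finset.sum_ite_eq,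
    Finset.mem_univ, if_true]

lemma IsSpinTriple.conj {u : Fin 3 → Matrix (Fin 2) (Fin 2) ℂ} (hu : IsSpinTriple u)
    {g : Matrix (Fin 2) (Fin 2) ℂ} (hg : g ∈ Matrix.specialUnitaryGroup (Fin 2) ℂ) :
    IsSpinTriple fun j => gᴴ * u j * g := by
  have hg1 : g * gᴴ = 1 :=
    Matrix.mem_unitaryGroup_iff.mp (Matrix.mem_specialUnitaryGroup_iff.mp hg).1
  have hg2 : gᴴ * g = 1 := mul_eq_one_comm.mp hg1
  refine ⟨fun j => ⟨?_, ?_⟩, fun h => hu.ne_zero ?_, fun j => ?_⟩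
  · simp [Matrix.conjTranspose_mul, (hu.mem j).1, Matrix.mul_assoc]
  · rw [Matrix.trace_mul_comm, ← Matrix.mul_assoc, hg1, Matrix.one_mul, (hu.mem j).2]
  · calc u 0 = (g * gᴴ) * u 0 * (g * gᴴ) := by rw [hg1, Matrix.one_mul, Matrix.mul_one]
      _ = g * (gᴴ * u 0 * g) * gᴴ := by simp only [Matrix.mul_assoc]
      _ = 0 := by rw [h]; simp
  · have e : ∀ A B : Matrix (Fin 2) (Fin 2) ℂ, gᴴ * A * g * (gᴴ * B * g) = gᴴ * (A * B) * g := by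
      intro A B
      calc gᴴ * A * g * (gᴴ * B * g) = gᴴ * A * (g * gᴴ) * B * g := by
            simp only [Matrix.mul_assoc]
        _ = _ := by rw [hg1, Matrix.mul_one]; simp only [Matrix.mul_assoc]
    have h := hu.lie_eq j
    rw [Ring.lie_def] at h ⊢
    rw [e, e, ← Matrix.sub_mul, ← Matrix.mul_sub, h]
    simp

/-- The map `spinGen d` as a real linear map. -/
def spinGenLin (d : ℕ) : Matrix (Fin 2) (Fin 2) ℂ →ₗ[ℝ] Matrix (Fin (d + 1)) (Fin (d + 1)) ℂ where
  toFun := spinGen d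
  map_add' := spinGen_add d
  map_smul' := spinGen_smul d

lemma sum_spinGen_pauliGen_mul (d : ℕ) :
    ∑ p, spinGen d (pauliGen p) * spinGen d (pauliGen p) = -((d * (d + 2) : ℝ) : ℂ) • 1 := by
  refine matrix_eq_of_powerVec fun z w => ?_
  rw [Fin.sum_univ_three]
  simp only [Matrix.add_mulVec, dotProduct_add, powerVec_spinGen_mul, Matrix.smul_mulVec,
    Matrix.one_mulVec, dotProduct_smul, powerVec_dotProduct, smul_eq_mul]
  have hs : ∀ p, pauliGen p * pauliGen p = -1 := by
    intro p
    ext i j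
    fin_cases p <;> fin_cases i <;> fin_cases j <;> simp [pauliGen, Matrix.mul_apply]
  have hf : (z ⬝ᵥ pauliGen 0 *ᵥ w) ^ 2 + (z ⬝ᵥ pauliGen 1 *ᵥ w) ^ 2 + (z ⬝ᵥ pauliGen 2 *ᵥ w) ^ 2 =
      -(z ⬝ᵥ w) ^ 2 := by
    simp only [pauliGen, dotProduct, Matrix.mulVec, Fin.sum_univ_two]
    simp
    ring_nf
    simp
    ring
  simp only [hs, Matrix.neg_mulVec, Matrix.one_mulVec, dotProduct_neg]
  generalize z ⬝ᵥ w = c at *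
  rcases d with _ | _ | d
  · simp
  · simp; ring
  · simp only [Nat.add_sub_cancel, show d + 1 + 1 - 2 = d by omega]
    push_cast
    linear_combination ((d : ℂ) + 2) * (d + 1) * c ^ d * hf

/-- The Casimir operator `∑ σ_j(s)²` is `d(d+2) = 4s(s+1)`. -/
lemma IsSpinTriple.casimir {u : Fin 3 → Matrix (Fin 2) (Fin 2) ℂ} (hu : IsSpinTriple u) (d : ℕ) :
    ∑ j, (Complex.I • spinGen d (u j)) * (Complex.I • spinGen d (u j)) =
      ((d * (d + 2) : ℝ) : ℂ) • 1 := by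
  have h := hu.sum_bilin ((LinearMap.mul ℝ _).compl₁₂ (spinGenLin d) (spinGenLin d))
  have h' : ∑ j, spinGen d (u j) * spinGen d (u j) = -((d * (d + 2) : ℝ) : ℂ) • 1 :=
    h.trans (sum_spinGen_pauliGen_mul d)
  simp only [Matrix.smul_mul, Matrix.mul_smul, smul_smul, Complex.I_mul_I, ← Finset.smul_sum, h']
  simp

/-! ### Expectations of spin operators in product states -/

lemma isSpinTriple_basis (u : Module.Basis (Fin 3) ℝ su2)
    (hu : ∀ j : Fin 3, ⁅(u j : Matrix (Fin 2) (Fin 2) ℂ), (u (j + 1) : Matrix (Fin 2) (Fin 2) ℂ)⁆ =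
      (2 : ℝ) • (u (j + 2) : Matrix (Fin 2) (Fin 2) ℂ)) :
    IsSpinTriple fun j => (u j : Matrix (Fin 2) (Fin 2) ℂ) :=
  ⟨fun j => (u j).2, fun h => u.ne_zero 0 (Subtype.ext h), hu⟩

lemma sigma_eq (d : ℕ) (u : Fin 3 → su2) (j : Fin 3) :
    sigma d u j = Complex.I • spinGen d (u j) := rfl

lemma conjTranspose_I_smul_spinGen (d : ℕ) {A : Matrix (Fin 2) (Fin 2) ℂ} (hA : A ∈ su2) :
    (Complex.I • spinGen d A)ᴴ = Complex.I • spinGen d A := by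
  have h := spinGen_smul d (-1) A
  rw [neg_one_smul, neg_one_smul] at h
  rw [Matrix.conjTranspose_smul, ← spinGen_conjTranspose, hA.1, h]
  simp

lemma inner_toEuclideanLin {n : Type*} [Fintype n] [DecidableEq n] (A : Matrix n n ℂ)
    (X Y : EuclideanSpace ℂ n) :
    inner ℂ (Matrix.toEuclideanLin A X) Y = inner ℂ X (Matrix.toEuclideanLin Aᴴ Y) := by
  rw [Matrix.toEuclideanLin_conjTranspose_eq_adjoint, LinearMap.adjoint_inner_right]

lemma toEuclideanLin_mul_apply {n : Type*} [Fintype n] [DecidableEq n] (A B : Matrix n n ℂ)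
    (X : EuclideanSpace ℂ n) : Matrix.toEuclideanLin (A * B) X =
      Matrix.toEuclideanLin A (Matrix.toEuclideanLin B X) := by
  simp [Matrix.toLpLin_apply, Matrix.mulVec_mulVec]

lemma inner_toEuclideanLin_self_real {n : Type*} [Fintype n] [DecidableEq n] {A : Matrix n n ℂ}
    (hA : Aᴴ = A) (X : EuclideanSpace ℂ n) :
    ((inner ℂ (Matrix.toEuclideanLin A X) X).re : ℂ) = inner ℂ (Matrix.toEuclideanLin A X) X := by
  refine Complex.conj_eq_iff_re.mp ?_
  rw [inner_conj_symm]
  conv_lhs => rw [← hA]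
  exact (inner_toEuclideanLin A X X).symm

lemma conjTranspose_mul_self_of_mem {g : Matrix (Fin 2) (Fin 2) ℂ}
    (hg : g ∈ Matrix.specialUnitaryGroup (Fin 2) ℂ) : gᴴ * g = 1 :=
  Matrix.mem_unitaryGroup_iff'.mp (Matrix.mem_specialUnitaryGroup_iff.mp hg).1

lemma spinRep_conjTranspose_mul_self (d : ℕ) {g : Matrix (Fin 2) (Fin 2) ℂ}
    (hg : g ∈ Matrix.specialUnitaryGroup (Fin 2) ℂ) : (spinRep d g)ᴴ * spinRep d g = 1 := by
  rw [← spinRep_conjTranspose, ← spinRep_mul,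
    conjTranspose_mul_self_of_mem hg, spinRep_one]

lemma norm_eq_one_of_mem_orbit {d : ℕ} {X₀ V : SpinSpace d} (hX₀ : ‖X₀‖ = 1)
    (hV : V ∈ orbit d X₀) : ‖V‖ = 1 := by
  obtain ⟨g, hg, rfl⟩ := hV
  have h : inner ℂ (Matrix.toEuclideanLin (spinRep d g) X₀) (Matrix.toEuclideanLin (spinRep d g) X₀)
      = inner ℂ X₀ X₀ := by
    rw [inner_toEuclideanLin, ← toEuclideanLin_mul_apply, spinRep_conjTranspose_mul_self d hg]
    simp
  rw [inner_self_eq_norm_sq_to_K, inner_self_eq_norm_sq_to_K, hX₀] at h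
  have h' : ‖Matrix.toEuclideanLin (spinRep d g) X₀‖ ^ 2 = 1 := by
    have := congrArg Complex.re h
    simpa [← Complex.ofReal_pow] using this
  exact (pow_eq_one_iff_of_nonneg (norm_nonneg _) two_ne_zero).mp h'

/-- The expectation `⟨i dρ(A) X, X⟩` in the state `X`, as a real linear function of `A`. -/
def spinExpectation (d : ℕ) (X : SpinSpace d) : Matrix (Fin 2) (Fin 2) ℂ →ₗ[ℝ] ℂ where
  toFun A := inner ℂ (Matrix.toEuclideanLin (Complex.I • spinGen d A) X) X
  map_add' A B := by rw [spinGen_add, smul_add, map_add, LinearMap.add_apply, inner_add_left]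
  map_smul' c A := by
    rw [spinGen_smul, smul_comm, RingHom.id_apply, ← Complex.coe_smul, map_smul,
      LinearMap.smul_apply, inner_smul_left, Complex.conj_ofReal, Complex.real_smul]

lemma IsSpinTriple.sum_spinExpectation_sq_eq {u v : Fin 3 → Matrix (Fin 2) (Fin 2) ℂ}
    (hu : IsSpinTriple u) (hv : IsSpinTriple v) (d : ℕ) (X : SpinSpace d) :
    ∑ j, spinExpectation d X (u j) ^ 2 = ∑ j, spinExpectation d X (v j) ^ 2 := by
  have h := fun {u} (hu : IsSpinTriple u) =>
    hu.sum_bilin ((LinearMap.mul ℝ ℂ).compl₁₂ (spinExpectation d X) (spinExpectation d X))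
  simp only [LinearMap.compl₁₂_apply, LinearMap.mul_apply', ← sq] at h
  rw [h hu, h hv]

lemma coe_hopf (d : ℕ) (u : Fin 3 → su2) (V : SpinSpace d) (j : Fin 3) :
    ((hopf d u V j : ℝ) : ℂ) = inner ℂ (Matrix.toEuclideanLin (sigma d u j) V) V :=
  inner_toEuclideanLin_self_real (conjTranspose_I_smul_spinGen d (u j).2) V

/-- The length of the classical spin is constant on the orbit of `SU(2)`: the rotated spin has the
same length in any triple of generators. -/
lemma sum_hopf_sq {d : ℕ} {u : Fin 3 → su2}
    (hu : IsSpinTriple fun j => (u j : Matrix (Fin 2) (Fin 2) ℂ)) {X₀ V : SpinSpace d}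
    (hX₀ : ∑ j, inner ℂ (Matrix.toEuclideanLin (sigma d u j) X₀) X₀ ^ 2 = 1)
    (hV : V ∈ orbit d X₀) : ∑ j, hopf d u V j ^ 2 = 1 := by
  obtain ⟨g, hg, rfl⟩ := hV
  set V := Matrix.toEuclideanLin (spinRep d g) X₀ with hVdef
  have hgg : gᴴ * g = 1 := conjTranspose_mul_self_of_mem hg
  have h1 : ∀ A, spinExpectation d V A = spinExpectation d X₀ (gᴴ * A * g) := by
    intro A
    change inner ℂ (Matrix.toEuclideanLin (Complex.I • spinGen d A) V) V =
      inner ℂ (Matrix.toEuclideanLin (Complex.I • spinGen d (gᴴ * A * g)) X₀) X₀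
    rw [← spinRep_mul_spinGen_mul d hgg, ← Matrix.smul_mul, ← Matrix.mul_smul,
      toEuclideanLin_mul_apply, toEuclideanLin_mul_apply, inner_toEuclideanLin (spinRep d gᴴ),
      spinRep_conjTranspose, Matrix.conjTranspose_conjTranspose]
  have h2 : ∑ j, ((hopf d u V j : ℝ) : ℂ) ^ 2 = 1 := by
    have h3 : ∀ j, ((hopf d u V j : ℝ) : ℂ) = spinExpectation d V (u j) := coe_hopf d u V
    simp only [h3, h1]
    rw [← hX₀]
    exact (hu.conj hg).sum_spinExpectation_sq_eq hu d X₀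
  exact_mod_cast h2

lemma toEuclideanLin_siteOp_productState {P d : ℕ} (l : Fin P)
    (A : Matrix (Fin (d + 1)) (Fin (d + 1)) ℂ) (V : Fin P → SpinSpace d) :
    Matrix.toEuclideanLin (siteOp l A) (productState V) =
      productState (Function.update V l (Matrix.toEuclideanLin A (V l))) := by
  refine PiLp.ext fun α => ?_
  simp only [Matrix.toLpLin_apply, productState, siteOp, Matrix.mulVec, dotProduct,
    Matrix.of_apply, ← Finset.prod_mul_distrib]
  rw [← Fintype.piFinset_univ, ← Finset.prod_univ_sum (fun _ => Finset.univ)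
    fun m b => (if m = l then A else 1) (α m) b * V m b]
  refine Finset.prod_congr rfl fun m _ => ?_
  rcases eq_or_ne m l with rfl | h
  · simp [Matrix.mulVec, dotProduct]
  · simp [h, Matrix.one_apply]

lemma inner_productState {P d : ℕ} (V W : Fin P → SpinSpace d) :
    inner ℂ (productState V) (productState W) = ∏ m, inner ℂ (V m) (W m) := by
  simp only [PiLp.inner_apply, productState, RCLike.inner_apply, map_prod,
    ← Finset.prod_mul_distrib]
  rw [← Fintype.piFinset_univ, ← Finset.prod_univ_sum (fun _ => Finset.univ)
    fun m b => W m b * (starRingEnd ℂ) (V m b)]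

lemma inner_siteOp_siteOp_of_ne {P d : ℕ} {l l' : Fin P} (h : l ≠ l')
    (A B : Matrix (Fin (d + 1)) (Fin (d + 1)) ℂ) {V : Fin P → SpinSpace d} (hV : ∀ m, ‖V m‖ = 1) :
    inner ℂ (Matrix.toEuclideanLin (siteOp l A)
        (Matrix.toEuclideanLin (siteOp l' B) (productState V))) (productState V) =
      inner ℂ (Matrix.toEuclideanLin A (V l)) (V l) *
        inner ℂ (Matrix.toEuclideanLin B (V l')) (V l') := by
  rw [toEuclideanLin_siteOp_productState, toEuclideanLin_siteOp_productState, inner_productState,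
    ← Finset.prod_subset (Finset.subset_univ {l, l'}), Finset.prod_pair h]
  · simp [h, h.symm]
  · intro m _ hm
    simp only [Finset.mem_insert, Finset.mem_singleton, not_or] at hm
    simp [hm.1, hm.2, inner_self_eq_norm_sq_to_K, hV]

lemma inner_siteOp_siteOp_self {P d : ℕ} (l : Fin P)
    (A B : Matrix (Fin (d + 1)) (Fin (d + 1)) ℂ) {V : Fin P → SpinSpace d} (hV : ∀ m, ‖V m‖ = 1) :
    inner ℂ (Matrix.toEuclideanLin (siteOp l A)
        (Matrix.toEuclideanLin (siteOp l B) (productState V))) (productState V) =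
      inner ℂ (Matrix.toEuclideanLin (A * B) (V l)) (V l) := by
  rw [toEuclideanLin_siteOp_productState, toEuclideanLin_siteOp_productState, inner_productState,
    Finset.prod_eq_single l]
  · simp
  · intro m _ hm
    simp [hm, inner_self_eq_norm_sq_to_K, hV]
  · simp

lemma sum_inner_sigma_mul_self {d : ℕ} {u : Fin 3 → su2}
    (hu : IsSpinTriple fun j => (u j : Matrix (Fin 2) (Fin 2) ℂ)) {V : SpinSpace d}
    (hV : ‖V‖ = 1) : ∑ m, inner ℂ (Matrix.toEuclideanLin (sigma d u m * sigma d u m) V) V =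
      ((d * (d + 2) : ℝ) : ℂ) := by
  rw [← sum_inner, ← LinearMap.sum_apply, ← map_sum]
  simp only [sigma_eq]
  rw [hu.casimir, map_smul, LinearMap.smul_apply, inner_smul_left, Complex.conj_ofReal]
  simp [inner_self_eq_norm_sq_to_K, hV]

/-! ### Graphs of partially defined operators -/

section

variable {E F G : Type*} [AddCommGroup E] [Module ℂ E] [AddCommGroup F] [Module ℂ F]
  [AddCommGroup G] [Module ℂ G]

lemma mem_graph_apply_eq {T : E →ₗ.[ℂ] F} {x : E} {y : F} (h : (x, y) ∈ T.graph)
    (hx : x ∈ T.domain) : T ⟨x, hx⟩ = y :=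
  ((LinearPMap.image_iff hx).mpr h).symm

lemma mem_graph_smul {T : E →ₗ.[ℂ] F} {x : E} {y : F} (c : ℂ) (h : (x, y) ∈ T.graph) :
    (x, c • y) ∈ (c • T).graph := by
  obtain ⟨z, hz, hy⟩ := (LinearPMap.mem_graph_iff T).mp h
  exact (LinearPMap.mem_graph_iff _).mpr ⟨z, hz, by rw [LinearPMap.smul_apply]; exact congrArg _ hy⟩

lemma mem_graph_neg {T : E →ₗ.[ℂ] F} {x : E} {y : F} (h : (x, y) ∈ T.graph) :
    (x, -y) ∈ (-T).graph := by
  obtain ⟨z, hz, hy⟩ := (LinearPMap.mem_graph_iff T).mp h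
  exact (LinearPMap.mem_graph_iff _).mpr ⟨z, hz, by rw [LinearPMap.neg_apply]; exact congrArg _ hy⟩

lemma mem_graph_add {T T' : E →ₗ.[ℂ] F} {x : E} {y y' : F} (h : (x, y) ∈ T.graph)
    (h' : (x, y') ∈ T'.graph) : (x, y + y') ∈ (T + T').graph := by
  have hx := LinearPMap.mem_domain_of_mem_graph h
  have hx' := LinearPMap.mem_domain_of_mem_graph h'
  refine (LinearPMap.mem_graph_iff _).mpr ⟨⟨x, hx, hx'⟩, rfl, ?_⟩
  rw [LinearPMap.add_apply, ← mem_graph_apply_eq h hx, ← mem_graph_apply_eq h' hx']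

lemma mem_graph_sum {ι : Type*} (s : Finset ι) {T : ι → E →ₗ.[ℂ] F} {x : E} {y : ι → F}
    (h : ∀ i, (x, y i) ∈ (T i).graph) : (x, ∑ i ∈ s, y i) ∈ (∑ i ∈ s, T i).graph := by
  classical
  induction s using Finset.induction_on with
  | empty => exact (LinearPMap.mem_graph_iff _).mpr ⟨⟨x, trivial⟩, rfl, rfl⟩
  | insert i s hi ih =>
    rw [Finset.sum_insert hi, Finset.sum_insert hi]
    exact mem_graph_add (h i) ih

lemma sum_smul_mem_graph {ι : Type*} (s : Finset ι) {T : E →ₗ.[ℂ] F} {x : ι → E} {y : ι → F}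
    (c : ι → ℂ) (h : ∀ i, (x i, y i) ∈ T.graph) :
    (∑ i ∈ s, c i • x i, ∑ i ∈ s, c i • y i) ∈ T.graph := by
  have h' := Submodule.sum_mem T.graph (t := s) fun i _ => Submodule.smul_mem _ (c i) (h i)
  convert h' using 1
  simp [Prod.ext_iff, Prod.fst_sum, Prod.snd_sum]

lemma mem_graph_pcomp {T : E →ₗ.[ℂ] F} {T' : F →ₗ.[ℂ] G} {x : E} {y : F} {z : G}
    (h : (x, y) ∈ T.graph) (h' : (y, z) ∈ T'.graph) : (x, z) ∈ (pcomp T' T).graph := by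
  obtain ⟨a, rfl, rfl⟩ := (LinearPMap.mem_graph_iff T).mp h
  obtain ⟨b, hb, rfl⟩ := (LinearPMap.mem_graph_iff T').mp h'
  refine (LinearPMap.mem_graph_iff _).mpr ⟨⟨(a : E), ⟨a, ?_, rfl⟩, a.2⟩, rfl, ?_⟩
  · exact LinearPMap.mem_domain_of_mem_graph h'
  · change T' _ = T' b
    congr 1
    exact Subtype.ext hb.symm

lemma mem_graph_compPMap {T : E →ₗ.[ℂ] F} {x : E} {y : F} (L : F →ₗ[ℂ] G)
    (h : (x, y) ∈ T.graph) : (x, L y) ∈ (L.compPMap T).graph := by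
  obtain ⟨z, hz, rfl⟩ := (LinearPMap.mem_graph_iff T).mp h
  exact (LinearPMap.mem_graph_iff _).mpr ⟨z, hz, rfl⟩

lemma mem_graph_tensorOp {κ H : Type*} [Fintype κ] [NormedAddCommGroup H] [InnerProductSpace ℂ H]
    {T : H →ₗ.[ℂ] H} (A : Matrix κ κ ℂ) {f g : κ → H} (h : ∀ β, (f β, g β) ∈ T.graph) :
    (WithLp.toLp 2 f, WithLp.toLp 2 fun α => ∑ β, A α β • g β) ∈ (tensorOp T A).graph := by
  refine (LinearPMap.mem_graph_iff _).mpr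
    ⟨⟨WithLp.toLp 2 f, fun β => LinearPMap.mem_domain_of_mem_graph (h β)⟩, rfl, ?_⟩
  refine PiLp.ext fun α => ?_
  refine Finset.sum_congr rfl fun β _ => ?_
  exact congrArg _ (mem_graph_apply_eq (h β) _)

lemma mem_graph_inverse {T : E →ₗ.[ℂ] F} (hT : ∀ x, (x, 0) ∈ T.graph → x = 0) {x : E} {y : F}
    (h : (x, y) ∈ T.graph) : (y, x) ∈ T.inverse.graph := by
  rw [LinearPMap.inverse_graph]
  · exact ⟨(x, y), h, rfl⟩
  · refine LinearMap.ker_eq_bot'.mpr fun z hz => Subtype.ext (hT z ?_)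
    exact (LinearPMap.mem_graph_iff T).mpr ⟨z, rfl, hz⟩

end

/-! ### The one photon sector -/

lemma sectorOne_ae : ((sectorOne : TensorL2 0) : (Fin 0 → Mode) → ℂ)
    =ᵐ[Measure.pi fun _ => modeMeasure] fun _ => 1 :=
  memLp_one_zero.coeFn_toLp

lemma tensorLeft_ae (V : VecL2) (n : ℕ) (f : TensorL2 n) :
    (tensorLeft V n f : (Fin (n + 1) → Mode) → ℂ) =ᵐ[Measure.pi fun _ => modeMeasure]
      fun q => V (q 0).1 (q 0).2 * f fun j => q j.succ :=
  (tensor_aux (memLp_uncurry V) (Lp.memLp f)).1.coeFn_toLp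

lemma tensorLeft_sectorOne_ae (V : VecL2) :
    (tensorLeft V 0 sectorOne : (Fin 1 → Mode) → ℂ) =ᵐ[Measure.pi fun _ => modeMeasure]
      fun q => V (q 0).1 (q 0).2 := by
  filter_upwards [tensorLeft_ae V 0 sectorOne, (tailMap 0).ae sectorOne_ae] with q h1 h2
  rw [h1, h2, mul_one]

/-- The one photon state `V`, as an element of the one photon sector. -/
def onePart (V : onePhoton) : photonSector 1 :=
  ⟨tensorLeft V 0 sectorOne, subset_closure (Submodule.subset_span ⟨V, V.2, by
    simpa using tensorLeft_sectorOne_ae V⟩)⟩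

lemma creation_sectorOne (V : onePhoton) : creation V 0 sectorOne = onePart V := by
  have h : (photonSector 1).orthogonalProjectionOnto (tensorLeft V 0 sectorOne) = onePart V :=
    Submodule.orthogonalProjectionOnto_mem_subspace_eq_self (onePart V)
  simp [creation, h]

/-- The one photon state `V` in the Fock space. -/
def onePhotonState (V : onePhoton) : Fock := lp.single 2 1 (onePart V)

/-- The Hilbert space structure of the one photon sector is that of `L²(ℝ³, ℂ³)`. -/
lemma inner_onePart (V W : onePhoton) :
    inner ℂ (onePart V) (onePart W) =
      ∫ k, ∑ a, (W : VecL2) k a * starRingEnd ℂ ((V : VecL2) k a) := by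
  have hint : Integrable (fun q : Mode => (W : VecL2) q.1 q.2 *
      starRingEnd ℂ ((V : VecL2) q.1 q.2)) modeMeasure :=
    MemLp.integrable_mul (memLp_uncurry W) (memLp_uncurry V).star
  have h1 : inner ℂ (onePart V) (onePart W) = ∫ q : Fin 1 → Mode,
      (W : VecL2) (q 0).1 (q 0).2 * starRingEnd ℂ ((V : VecL2) (q 0).1 (q 0).2)
        ∂(Measure.pi fun _ => modeMeasure) := by
    rw [Submodule.coe_inner, L2.inner_def]
    refine integral_congr_ae ?_
    filter_upwards [tensorLeft_sectorOne_ae (V : VecL2), tensorLeft_sectorOne_ae (W : VecL2)]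
      with q hV hW
    change inner ℂ (tensorLeft (V : VecL2) 0 sectorOne q) (tensorLeft (W : VecL2) 0 sectorOne q) = _
    rw [hV, hW, RCLike.inner_apply]
  have h2 := (measurePreserving_funUnique modeMeasure (Fin 1)).integral_comp'
    (fun q : Mode => (W : VecL2) q.1 q.2 * starRingEnd ℂ ((V : VecL2) q.1 q.2))
  refine h1.trans (h2.trans ?_)
  rw [modeMeasure] at hint ⊢
  rw [integral_prod _ hint]
  refine integral_congr_ae (Filter.Eventually.of_forall fun k => ?_)
  simp [integral_fintype, Integrable.of_finite]

lemma mem_graph_segalField (V : onePhoton) {f g : Fock} (h : ∀ n, g n = segalComponent V n f) :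
    (f, g) ∈ (segalField V).graph := by
  rw [segalField, Submodule.toLinearPMap_graph_eq]
  · exact h
  · intro p hp h0
    refine lp.ext (funext fun n => ?_)
    rw [hp n, h0, map_zero]
    rfl

lemma mem_graph_dGammaMul (w : R3 → ℝ) {f g : Fock} :
    (f, g) ∈ (dGammaMul w).graph ↔ ∀ n, ((g n : TensorL2 n) : (Fin n → Mode) → ℂ)
      =ᵐ[Measure.pi fun _ => modeMeasure]
        fun q => ((∑ i, w (q i).1 : ℝ) : ℂ) * (f n : TensorL2 n) q := by
  rw [dGammaMul, Submodule.toLinearPMap_graph_eq]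
  · rfl
  · intro p hp h0
    refine lp.ext (funext fun n => Subtype.ext (Lp.ext ?_))
    filter_upwards [hp n, Lp.coeFn_zero ℂ 2 (Measure.pi fun _ : Fin n => modeMeasure)] with q h1 h2
    rw [h1, h0]
    change _ * (0 : TensorL2 n) q = (0 : TensorL2 n) q
    rw [h2]
    simp

lemma vacuum_apply_zero : vacuum 0 = sectorOne := lp.single_apply_self _ _ _

lemma vacuum_apply_succ (n : ℕ) : vacuum (n + 1) = 0 :=
  lp.single_apply_ne _ _ _ n.succ_ne_zero

lemma onePhotonState_apply_one (V : onePhoton) : onePhotonState V 1 = onePart V :=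
  lp.single_apply_self _ _ _

lemma onePhotonState_apply_ne (V : onePhoton) {n : ℕ} (hn : n ≠ 1) : onePhotonState V n = 0 :=
  lp.single_apply_ne _ _ _ hn

lemma segalField_vacuum (V : onePhoton) :
    (vacuum, ((Real.sqrt 2 : ℝ) : ℂ)⁻¹ • onePhotonState V) ∈ (segalField V).graph := by
  refine mem_graph_segalField V fun n => ?_
  rw [lp.coeFn_smul, Pi.smul_apply]
  rcases n with _ | _ | n
  · simp [segalComponent, vacuum_apply_succ 0, onePhotonState_apply_ne V zero_ne_one]
  · simp [segalComponent, vacuum_apply_succ, vacuum_apply_zero, creation_sectorOne,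
      onePhotonState_apply_one]
  · simp [segalComponent, vacuum_apply_succ, onePhotonState_apply_ne V (n := n + 2) (by omega)]

/-- The value of the Segal field on a one photon state; only its vacuum component matters. -/
lemma exists_segalField_onePhotonState (V W : onePhoton) :
    ∃ g : Fock, (onePhotonState W, g) ∈ (segalField V).graph ∧
      inner ℂ vacuum g = ((Real.sqrt 2 : ℝ) : ℂ)⁻¹ * inner ℂ (onePart V) (onePart W) := by
  refine ⟨((Real.sqrt 2 : ℝ) : ℂ)⁻¹ • (lp.single 2 0 (annihilation V 0 (onePart W)) +
    lp.single 2 2 (creation V 1 (onePart W))), mem_graph_segalField V fun n => ?_, ?_⟩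
  · rw [lp.coeFn_smul, Pi.smul_apply, lp.coeFn_add, Pi.add_apply]
    rcases n with _ | _ | _ | n
    · simp [segalComponent, onePhotonState_apply_one]
    · simp [segalComponent, onePhotonState_apply_ne W (n := 2) (by omega),
        onePhotonState_apply_ne W (n := 0) (by omega)]
    · simp [segalComponent, onePhotonState_apply_ne W (n := 3) (by omega),
        onePhotonState_apply_one]
    · simp [segalComponent, onePhotonState_apply_ne W (n := n + 4) (by omega),
        onePhotonState_apply_ne W (n := n + 2) (by omega)]
  · rw [inner_smul_right, vacuum, lp.inner_single_left, lp.coeFn_add, Pi.add_apply,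
      lp.single_apply_self, lp.single_apply_ne _ _ _ (by omega), add_zero, annihilation,
      ContinuousLinearMap.adjoint_inner_right, creation_sectorOne]

lemma ae_sum_norm_ne_zero (n : ℕ) :
    ∀ᵐ q ∂(Measure.pi fun _ : Fin (n + 1) => modeMeasure), (∑ i, ‖(q i).1‖ : ℝ) ≠ 0 := by
  have h1 : ∀ᵐ k : R3, k ≠ 0 := Measure.ae_ne volume 0
  have h2 : ∀ᵐ q ∂modeMeasure, q.1 ≠ 0 := Measure.quasiMeasurePreserving_fst.ae h1
  filter_upwards [(Measure.quasiMeasurePreserving_fst.comp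
    (succMap n).quasiMeasurePreserving).ae h2] with q hq
  have hq' : (q 0).1 ≠ 0 := hq
  exact (Finset.sum_pos' (s := Finset.univ) (f := fun i : Fin (n + 1) => ‖(q i).1‖)
    (fun i _ => norm_nonneg _) ⟨0, Finset.mem_univ _, norm_pos_iff.mpr hq'⟩).ne'

lemma eq_smul_sectorOne (f : photonSector 0) : ∃ c : ℂ, f = c • sectorOne := by
  refine ⟨(f : TensorL2 0) default, Subtype.ext (Lp.ext ?_)⟩
  filter_upwards [Lp.coeFn_smul ((f : TensorL2 0) default) (sectorOne : TensorL2 0),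
    sectorOne_ae] with q h1 h2
  change _ = ((f : TensorL2 0) default • (sectorOne : TensorL2 0) : TensorL2 0) q
  rw [h1, Pi.smul_apply, h2, smul_eq_mul, mul_one, Subsingleton.elim q default]

/-- The vacuum spans the kernel of the free Hamiltonian, so its restriction to the orthogonal
complement can be inverted. -/
lemma eq_zero_of_photonHamiltonian_eq_zero {f : Fock} (hf : f ∈ (Submodule.span ℂ {vacuum})ᗮ)
    (h : (f, 0) ∈ photonHamiltonian.graph) : f = 0 := by
  rw [photonHamiltonian, mem_graph_dGammaMul] at h
  refine lp.ext (funext fun n => ?_)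
  rcases n with _ | n
  · obtain ⟨c, hc⟩ := eq_smul_sectorOne (f 0)
    have h0 : inner ℂ vacuum f = 0 := Submodule.mem_orthogonal_singleton_iff_inner_right.mp hf
    rw [vacuum, lp.inner_single_left, hc] at h0
    have h1 := (inner_smul_right (𝕜 := ℂ) sectorOne sectorOne c).symm.trans h0
    rw [hc]
    rcases mul_eq_zero.mp h1 with h0 | h0
    · rw [h0, zero_smul]; rfl
    · rw [inner_self_eq_zero.mp h0, smul_zero]; rfl
  · refine Subtype.ext (Lp.ext ?_)
    filter_upwards [h (n + 1), ae_sum_norm_ne_zero n,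
      Lp.coeFn_zero ℂ 2 (Measure.pi fun _ : Fin (n + 1) => modeMeasure)] with q h1 h2 h3
    change (0 : TensorL2 (n + 1)) q = _ at h1
    change _ = (0 : TensorL2 (n + 1)) q
    rw [h3] at h1 ⊢
    exact (mul_eq_zero.mp h1.symm).resolve_left (by exact_mod_cast h2)

lemma photonHamiltonianInv_onePhotonState {V W : onePhoton}
    (h : ∀ᵐ k, ∀ a, (V : VecL2) k a = ‖k‖ * (W : VecL2) k a) :
    (onePhotonState V, onePhotonState W) ∈ photonHamiltonianInv.graph := by
  have h1 : (onePhotonState W, onePhotonState V) ∈ photonHamiltonian.graph := by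
    rw [photonHamiltonian, mem_graph_dGammaMul]
    intro n
    rcases eq_or_ne n 1 with rfl | hn
    · have h2 : ∀ᵐ q ∂modeMeasure, ∀ a, (V : VecL2) q.1 a = ‖q.1‖ * (W : VecL2) q.1 a :=
        Measure.quasiMeasurePreserving_fst.ae h
      filter_upwards [(Measure.quasiMeasurePreserving_fst.comp
        (succMap 0).quasiMeasurePreserving).ae h2, tensorLeft_sectorOne_ae (V : VecL2),
        tensorLeft_sectorOne_ae (W : VecL2)] with q h3 hV hW
      rw [onePhotonState_apply_one, onePhotonState_apply_one]
      change tensorLeft (V : VecL2) 0 sectorOne q = _ * tensorLeft (W : VecL2) 0 sectorOne q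
      rw [hV, hW]
      have h4 : ∀ a, (V : VecL2) (q 0).1 a = ‖(q 0).1‖ * (W : VecL2) (q 0).1 a := h3
      simpa using h4 (q 0).2
    · rw [onePhotonState_apply_ne V hn, onePhotonState_apply_ne W hn]
      filter_upwards [Lp.coeFn_zero ℂ 2 (Measure.pi fun _ : Fin n => modeMeasure)] with q h3
      change (0 : TensorL2 n) q = _ * (0 : TensorL2 n) q
      rw [h3]
      simp
  have h2 : onePhotonState W ∈ (Submodule.span ℂ {vacuum})ᗮ := by
    rw [Submodule.mem_orthogonal_singleton_iff_inner_right, vacuum, lp.inner_single_left,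
      onePhotonState_apply_ne W zero_ne_one, inner_zero_right]
  refine mem_graph_inverse (fun f hf => ?_) ?_
  · have hf' := LinearPMap.mem_domain_of_mem_graph hf
    exact eq_zero_of_photonHamiltonian_eq_zero hf'.1
      (LinearPMap.le_graph_of_le LinearPMap.domRestrict_le hf)
  · refine (LinearPMap.mem_graph_iff _).mpr ⟨⟨onePhotonState W, h2,
      LinearPMap.mem_domain_of_mem_graph h1⟩, rfl, ?_⟩
    exact mem_graph_apply_eq h1 _

/-! ### The second order operator -/

lemma integrable_pow_mul_abs_norm (φ : 𝓢(ℝ, ℝ)) (n : ℕ) :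
    Integrable fun k : R3 => ‖k‖ ^ n * |φ ‖k‖| := by
  refine (integrable_fun_norm_addHaar (volume : Measure R3) (f := fun y => y ^ n * |φ y|)).mpr ?_
  refine (φ.integrable_pow_mul volume (n + 2)).integrableOn.congr_fun (fun y hy => ?_)
    measurableSet_Ioi
  have hy' : (0 : ℝ) < y := hy
  simp [abs_of_pos hy', pow_add]
  ring

lemma integrable_pow_mul_sq (φ : 𝓢(ℝ, ℝ)) (n : ℕ) : Integrable fun y : ℝ => |y| ^ n * φ y ^ 2 := by
  obtain ⟨C, hC⟩ := φ.decay 0 0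
  have h := (φ.integrable_pow_mul volume n).mul_bdd (g := fun y => |φ y|) (c := C)
    (φ.continuous.abs.aestronglyMeasurable) (Filter.Eventually.of_forall fun y => by
      simpa using hC.2 y)
  refine h.congr (Filter.Eventually.of_forall fun y => ?_)
  simp only [Real.norm_eq_abs]
  rw [← sq_abs (φ y)]
  ring

lemma integrable_sq_norm (φ : 𝓢(ℝ, ℝ)) : Integrable fun k : R3 => φ ‖k‖ ^ 2 := by
  refine (integrable_fun_norm_addHaar (volume : Measure R3) (f := fun y => φ y ^ 2)).mpr ?_
  refine (integrable_pow_mul_sq φ 2).integrableOn.congr_fun (fun y hy => ?_) measurableSet_Ioi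
  simp

/-- In dimension three the infrared singularity `|k|⁻¹` is integrable; this puts `|k|⁻¹ B_{m,x}`
into `L²`. -/
lemma integrable_inv_mul_sq_norm (φ : 𝓢(ℝ, ℝ)) :
    Integrable fun k : R3 => ‖k‖⁻¹ * φ ‖k‖ ^ 2 := by
  refine (integrable_fun_norm_addHaar (volume : Measure R3) (f := fun y => y⁻¹ * φ y ^ 2)).mpr ?_
  refine (integrable_pow_mul_sq φ 1).integrableOn.congr_fun (fun y hy => ?_) measurableSet_Ioi
  have hy' : (0 : ℝ) < y := hy
  simp [abs_of_pos hy']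
  field_simp

lemma measurable_comp_norm (φ : 𝓢(ℝ, ℝ)) : Measurable fun k : R3 => φ ‖k‖ :=
  (φ.continuous.comp continuous_norm).measurable

lemma norm_exp_neg_I_mul (t : ℝ) : ‖Complex.exp (-(Complex.I * (t : ℂ)))‖ = 1 := by
  have : -(Complex.I * (t : ℂ)) = ((-t : ℝ) : ℂ) * Complex.I := by push_cast; ring
  rw [this, Complex.norm_exp_ofReal_mul_I]

/-- The function `|k|⁻¹ B_{m,x}(k)`. -/
def potentialFun (φ : 𝓢(ℝ, ℝ)) (m : Fin 3) (x k : R3) : EuclideanSpace ℂ (Fin 3) :=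
  ((‖k‖⁻¹ : ℝ) : ℂ) • fieldFun φ m x k

lemma memLp_potentialFun (φ : 𝓢(ℝ, ℝ)) (m : Fin 3) (x : R3) :
    MemLp (potentialFun φ m x) 2 (volume : Measure R3) := by
  rw [memLp_piLp_iff]
  intro a
  have hmeas : Measurable fun k => potentialFun φ m x k a := by
    have h1 := measurable_cross m a
    have h2 := measurable_comp_norm φ
    simp only [potentialFun, fieldFun, PiLp.smul_apply, smul_eq_mul]
    fun_prop
  rw [memLp_two_iff_integrable_sq_norm hmeas.aestronglyMeasurable]
  refine (integrable_inv_mul_sq_norm φ).mono' (hmeas.norm.pow_const 2).aestronglyMeasurable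
    (Filter.Eventually.of_forall fun k => ?_)
  rcases eq_or_ne k 0 with rfl | hk
  · simp [potentialFun]
  have hk' : 0 < ‖k‖ := norm_pos_iff.mpr hk
  have hc : |cross k (e m) a / ‖k‖| ≤ 1 := by
    rw [abs_div, abs_norm]
    exact div_le_one_of_le₀ (abs_cross_le k m a) (norm_nonneg k)
  have hpi : (1 : ℝ) ≤ (2 * Real.pi) ^ (3 / 2 : ℝ) :=
    Real.one_le_rpow (by linarith [Real.two_le_pi]) (by norm_num)
  have hroot : (‖k‖ ^ (1 / 2 : ℝ)) ^ 2 = ‖k‖ := by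
    rw [← Real.rpow_natCast, ← Real.rpow_mul hk'.le]; norm_num
  simp only [potentialFun, fieldFun, PiLp.smul_apply, smul_eq_mul, norm_mul, Complex.norm_I,
    one_mul, Complex.norm_real, norm_exp_neg_I_mul, mul_one, Real.norm_eq_abs, norm_pow, abs_abs]
  have h1 : |φ ‖k‖ * ‖k‖ ^ (1 / 2 : ℝ) / (2 * Real.pi) ^ (3 / 2 : ℝ)| ≤
      |φ ‖k‖ * ‖k‖ ^ (1 / 2 : ℝ)| := by
    rw [abs_div, abs_of_nonneg (by positivity : 0 ≤ (2 * Real.pi) ^ (3 / 2 : ℝ))]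
    exact div_le_self (abs_nonneg _) hpi
  calc (|‖k‖⁻¹| * (|φ ‖k‖ * ‖k‖ ^ (1 / 2 : ℝ) / (2 * Real.pi) ^ (3 / 2 : ℝ)| *
        |cross k (e m) a / ‖k‖|)) ^ 2
      ≤ (|‖k‖⁻¹| * (|φ ‖k‖ * ‖k‖ ^ (1 / 2 : ℝ)| * 1)) ^ 2 := by gcongr
    _ = ‖k‖⁻¹ ^ 2 * φ ‖k‖ ^ 2 * (‖k‖ ^ (1 / 2 : ℝ)) ^ 2 := by
        rw [mul_one, ← abs_mul, sq_abs]; ring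
    _ = ‖k‖⁻¹ * φ ‖k‖ ^ 2 := by rw [hroot]; field_simp

/-- The one photon state `dΓ(M_ω)⁻¹ B_{m,x}`. -/
def potentialState (φ : 𝓢(ℝ, ℝ)) (m : Fin 3) (x : R3) : onePhoton :=
  ⟨(memLp_potentialFun φ m x).toLp, by
    filter_upwards [(memLp_potentialFun φ m x).coeFn_toLp] with k hk
    rw [hk]
    fin_cases m <;>
      simp [potentialFun, fieldFun, cross, e, cross_apply, Fin.sum_univ_three] <;> ring⟩

lemma photonHamiltonianInv_fieldState (φ : 𝓢(ℝ, ℝ)) (m : Fin 3) (x : R3) :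
    (onePhotonState (fieldState φ m x), onePhotonState (potentialState φ m x)) ∈
      photonHamiltonianInv.graph := by
  refine photonHamiltonianInv_onePhotonState ?_
  filter_upwards [(memLp_fieldFun φ m x).coeFn_toLp, (memLp_potentialFun φ m x).coeFn_toLp,
    Measure.ae_ne volume 0] with k h1 h2 h3 a
  have hk : (‖k‖ : ℂ) ≠ 0 := by exact_mod_cast norm_ne_zero_iff.mpr h3
  change ((memLp_fieldFun φ m x).toLp _ : VecL2) k a =
    _ * ((memLp_potentialFun φ m x).toLp _ : VecL2) k a
  rw [h1, h2, potentialFun, PiLp.smul_apply, smul_eq_mul, Complex.ofReal_inv,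
    mul_inv_cancel_left₀ hk]

lemma sum_cross_mul_cross (k : R3) (m m' : Fin 3) :
    ∑ a, cross k (e m) a * cross k (e m') a = (if m = m' then ‖k‖ ^ 2 else 0) - k m * k m' := by
  rw [EuclideanSpace.norm_sq_eq]
  fin_cases m <;> fin_cases m' <;>
    simp [cross, e, cross_apply, Fin.sum_univ_three] <;> ring

/-- The matrix `(δ_{jm} |k|² - k_j k_m) / |k|²` of the projection onto the plane orthogonal to
`k`. -/
def transverseMatrix (j m : Fin 3) (k : R3) : ℝ :=
  ((if j = m then ‖k‖ ^ 2 else 0) - k j * k m) / ‖k‖ ^ 2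

/-- The coefficients `A_{jm}` are the matrix elements of `dΓ(M_ω)⁻¹` between the one photon states
`B_{j,x}`. -/
lemma inner_onePart_fieldState (φ : 𝓢(ℝ, ℝ)) (m m' : Fin 3) (x x' : R3) :
    inner ℂ (onePart (fieldState φ m x)) (onePart (potentialState φ m' x')) =
      transverseCoeff φ m m' (x' - x) := by
  rw [inner_onePart, transverseCoeff, ← integral_const_mul]
  refine integral_congr_ae ?_
  filter_upwards [(memLp_fieldFun φ m x).coeFn_toLp, (memLp_potentialFun φ m' x').coeFn_toLp,
    Measure.ae_ne volume 0] with k h1 h2 h3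
  have hk : 0 < ‖k‖ := norm_pos_iff.mpr h3
  change ∑ a, ((memLp_potentialFun φ m' x').toLp _ : VecL2) k a *
    starRingEnd ℂ (((memLp_fieldFun φ m x).toLp _ : VecL2) k a) = _
  rw [h1, h2]
  have hroot : ‖k‖ ^ (1 / 2 : ℝ) * ‖k‖ ^ (1 / 2 : ℝ) = ‖k‖ := by
    rw [← Real.rpow_add hk]; norm_num
  have hpi : (2 * Real.pi) ^ (3 / 2 : ℝ) * (2 * Real.pi) ^ (3 / 2 : ℝ) = (2 * Real.pi) ^ 3 := by
    rw [← Real.rpow_add (by positivity)]; norm_num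
  set A : ℝ := φ ‖k‖ * ‖k‖ ^ (1 / 2 : ℝ) / (2 * Real.pi) ^ (3 / 2 : ℝ) with hA
  have hA2 : A * A = ((2 * Real.pi) ^ 3)⁻¹ * (|φ ‖k‖| ^ 2 * ‖k‖) := by
    rw [sq_abs, hA, div_mul_div_comm, hpi, mul_mul_mul_comm, hroot]
    field_simp
  have hexp : Complex.exp (-(Complex.I * ((inner ℝ k x' : ℝ) : ℂ))) *
      starRingEnd ℂ (Complex.exp (-(Complex.I * ((inner ℝ k x : ℝ) : ℂ)))) =
        Complex.exp (-(Complex.I * ((inner ℝ k (x' - x) : ℝ) : ℂ))) := by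
    rw [← Complex.exp_conj, ← Complex.exp_add, inner_sub_right]
    congr 1
    simp
    ring
  have hterm : ∀ a, potentialFun φ m' x' k a * starRingEnd ℂ (fieldFun φ m x k a) =
      Complex.exp (-(Complex.I * ((inner ℝ k (x' - x) : ℝ) : ℂ))) *
        ((‖k‖⁻¹ * (A * A) * (cross k (e m) a * cross k (e m') a) / ‖k‖ ^ 2 : ℝ) : ℂ) := by
    intro a
    rw [← hexp]
    simp only [potentialFun, fieldFun, PiLp.smul_apply, smul_eq_mul, ← hA, map_mul, map_div₀,
      Complex.conj_I, Complex.conj_ofReal, Complex.ofReal_mul, Complex.ofReal_div,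
      Complex.ofReal_pow]
    linear_combination (-(‖k‖⁻¹ : ℝ) * A * A *
      Complex.exp (-(Complex.I * ((inner ℝ k x' : ℝ) : ℂ))) *
      starRingEnd ℂ (Complex.exp (-(Complex.I * ((inner ℝ k x : ℝ) : ℂ)))) *
      (cross k (e m) a) * (cross k (e m') a) / ‖k‖ ^ 2 : ℂ) * Complex.I_sq
  simp only [hterm]
  rw [← Finset.mul_sum, ← Complex.ofReal_sum, ← Finset.sum_div, ← Finset.mul_sum,
    sum_cross_mul_cross, hA2]
  have hreal : ‖k‖⁻¹ * (((2 * Real.pi) ^ 3)⁻¹ * (|φ ‖k‖| ^ 2 * ‖k‖)) *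
      ((if m = m' then ‖k‖ ^ 2 else 0) - k m * k m') / ‖k‖ ^ 2 =
      ((2 * Real.pi) ^ 3)⁻¹ * |φ ‖k‖| ^ 2 *
        (((if m = m' then ‖k‖ ^ 2 else 0) - k m * k m') / ‖k‖ ^ 2) := by
    field_simp
  rw [hreal]
  push_cast
  ring

lemma toEuclideanLin_apply_apply {n : Type*} [Fintype n] [DecidableEq n] (A : Matrix n n ℂ)
    (X : EuclideanSpace ℂ n) (i : n) : Matrix.toEuclideanLin A X i = ∑ j, A i j * X j := by
  rw [Matrix.toLpLin_apply]
  rfl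

lemma adjoint_embed_apply {P d : ℕ} (f : TotalSpace P d) (α : Config P d) :
    ContinuousLinearMap.adjoint (embed P d) f α = inner ℂ vacuum (f α) := by
  have h := ContinuousLinearMap.adjoint_inner_right (embed P d) (EuclideanSpace.single α 1) f
  rw [EuclideanSpace.inner_single_left] at h
  simp only [map_one, one_mul] at h
  rw [h, PiLp.inner_apply, Finset.sum_eq_single α]
  · change inner ℂ ((EuclideanSpace.single α (1 : ℂ) : SpinStates P d) α • vacuum) (f α) = _
    simp
  · intro β _ hβ
    change inner ℂ ((EuclideanSpace.single α (1 : ℂ) : SpinStates P d) β • vacuum) (f β) = _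
    simp [hβ]
  · simp

/-- The operator `A_M` is defined everywhere. The first interaction creates a photon from the
vacuum, the second one absorbs it (its two photon part is killed by `E*`), and what remains is a
double sum over the sources of the photon. -/
lemma mem_graph_secondOrderOp {P : ℕ} (d : ℕ) (u : Fin 3 → su2) (φ : 𝓢(ℝ, ℝ)) (x : Fin P → R3)
    (M : Fin P → ℝ) (X : SpinStates P d) :
    (X, -∑ i : Fin P × Fin 3, ∑ j : Fin P × Fin 3,
      ((M i.1 * M j.1 : ℝ) / 2 * transverseCoeff φ i.2 j.2 (x j.1 - x i.1) : ℂ) •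
        Matrix.toEuclideanLin (siteOp i.1 (sigma d u i.2))
          (Matrix.toEuclideanLin (siteOp j.1 (sigma d u j.2)) X)) ∈
      (secondOrderOp d u φ x M).graph := by
  set S : Fin P × Fin 3 → Matrix (Config P d) (Config P d) ℂ :=
    fun i => siteOp i.1 (sigma d u i.2) with hS
  set r : ℂ := ((Real.sqrt 2 : ℝ) : ℂ)⁻¹ with hr
  have hrr : r * r = 1 / 2 := by
    rw [hr, ← Complex.ofReal_inv, ← Complex.ofReal_mul, ← mul_inv,
      Real.mul_self_sqrt (by norm_num)]
    norm_num
  have hH : interaction d u φ x M = ∑ i : Fin P × Fin 3, ((M i.1 : ℝ) : ℂ) •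
      tensorOp (segalField (fieldState φ i.2 (x i.1))) (S i) := by
    rw [Fintype.sum_prod_type]
    rfl
  -- The coefficient of the `i`-th one photon state in the component `α` of `H_int E X`.
  set c : Fin P × Fin 3 → Config P d → ℂ := fun i α =>
    M i.1 * r * Matrix.toEuclideanLin (S i) X α with hc
  have h0 : (X, embed P d X) ∈ ((embed P d).toLinearMap.toPMap ⊤).graph :=
    (LinearPMap.mem_graph_iff _).mpr ⟨⟨X, trivial⟩, rfl, rfl⟩
  have h1 : (embed P d X, WithLp.toLp 2 fun α => ∑ i, c i α •
      onePhotonState (fieldState φ i.2 (x i.1))) ∈ (interaction d u φ x M).graph := by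
    have h := fun i : Fin P × Fin 3 => mem_graph_smul ((M i.1 : ℝ) : ℂ)
      (mem_graph_tensorOp (S i) (f := fun β => X β • vacuum)
        (g := fun β => X β • r • onePhotonState (fieldState φ i.2 (x i.1)))
        fun β => Submodule.smul_mem _ (X β) (segalField_vacuum (fieldState φ i.2 (x i.1))))
    have h' := mem_graph_sum Finset.univ h
    rw [hH]
    suffices hw : (WithLp.toLp 2 fun α => ∑ i, c i α • onePhotonState (fieldState φ i.2 (x i.1)) :
        TotalSpace P d) = ∑ i : Fin P × Fin 3, ((M i.1 : ℝ) : ℂ) • (WithLp.toLp 2 fun α =>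
          ∑ β, S i α β • X β • r • onePhotonState (fieldState φ i.2 (x i.1)) : TotalSpace P d) by
      rw [hw]
      exact h'
    refine PiLp.ext fun α => ?_
    simp only [WithLp.ofLp_sum, Finset.sum_apply, PiLp.smul_apply, hc]
    refine Finset.sum_congr rfl fun i _ => ?_
    simp only [smul_smul, ← Finset.sum_smul]
    congr 1
    simp only [toEuclideanLin_apply_apply, Finset.mul_sum]
    exact Finset.sum_congr rfl fun β _ => by ring
  have h2 : ((WithLp.toLp 2 fun α => ∑ i, c i α • onePhotonState (fieldState φ i.2 (x i.1)) :
      TotalSpace P d), (WithLp.toLp 2 fun α => ∑ i, c i α •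
        onePhotonState (potentialState φ i.2 (x i.1)) : TotalSpace P d)) ∈
      (tensorOp photonHamiltonianInv (1 : Matrix (Config P d) (Config P d) ℂ)).graph := by
    have hg : ∀ α, (∑ i, c i α • onePhotonState (fieldState φ i.2 (x i.1)),
        ∑ i, c i α • onePhotonState (potentialState φ i.2 (x i.1))) ∈
          photonHamiltonianInv.graph := by
      exact fun α => sum_smul_mem_graph _ _ fun i => photonHamiltonianInv_fieldState φ i.2 (x i.1)
    have h := mem_graph_tensorOp (1 : Matrix (Config P d) (Config P d) ℂ) hg
    simpa [Matrix.one_apply, ite_smul] using h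
  choose G hG hGv using fun i j : Fin P × Fin 3 => exists_segalField_onePhotonState
    (fieldState φ i.2 (x i.1)) (potentialState φ j.2 (x j.1))
  have h3 : ((WithLp.toLp 2 fun α => ∑ i, c i α • onePhotonState (potentialState φ i.2 (x i.1)) :
      TotalSpace P d), ∑ i : Fin P × Fin 3, ((M i.1 : ℝ) : ℂ) •
        (WithLp.toLp 2 fun α => ∑ β, S i α β • ∑ j, c j β • G i j : TotalSpace P d)) ∈
      (interaction d u φ x M).graph := by
    rw [hH]
    refine mem_graph_sum Finset.univ fun i => mem_graph_smul _
      (mem_graph_tensorOp (S i) fun β => ?_)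
    exact sum_smul_mem_graph _ _ (hG i)
  have h4 := mem_graph_neg (mem_graph_compPMap (ContinuousLinearMap.adjoint (embed P d)).toLinearMap
    (mem_graph_pcomp (mem_graph_pcomp (mem_graph_pcomp h0 h1) h2) h3))
  refine (congrArg (fun w => (X, -w) ∈ (secondOrderOp d u φ x M).graph) ?_).mpr h4
  refine PiLp.ext fun α => ?_
  refine Eq.trans ?_ (adjoint_embed_apply _ α).symm
  simp only [WithLp.ofLp_sum, Finset.sum_apply, PiLp.smul_apply, inner_sum, inner_smul_right, hGv,
    inner_onePart_fieldState]
  refine Finset.sum_congr rfl fun i _ => ?_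
  simp only [toEuclideanLin_apply_apply (siteOp i.1 (sigma d u i.2)), Finset.mul_sum, smul_eq_mul]
  rw [Finset.sum_comm]
  refine Finset.sum_congr rfl fun β _ => Finset.sum_congr rfl fun j _ => ?_
  simp only [hc, ← hr]
  push_cast
  change _ = (M i.1 : ℂ) * (S i α β * (M j.1 * r * Matrix.toEuclideanLin (S j) X β * _))
  linear_combination (-(M i.1 : ℂ) * M j.1 * transverseCoeff φ i.2 j.2 (x j.1 - x i.1) *
    siteOp i.1 (sigma d u i.2) α β * Matrix.toEuclideanLin (siteOp j.1 (sigma d u j.2)) X β) * hrr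

/-! ### The inverse Fourier transform -/

open FourierTransform in
/-- On `L¹ ∩ L²` the Fourier transform of `L²`, which is defined by density, is given by the
integral. -/
lemma toLp_fourier_ae_eq {f : R3 → ℂ} (hf1 : Integrable f) (hf2 : MemLp f 2) :
    (𝓕 (hf2.toLp f) : Lp ℂ 2 (volume : Measure R3)) =ᵐ[volume] 𝓕 f := by
  have hcont : Continuous (𝓕 f) := VectorFourier.fourierIntegral_continuous
    Real.continuous_fourierChar continuous_inner hf1
  refine ae_eq_of_integral_contDiff_smul_eq ((Lp.memLp _).locallyIntegrable (by norm_num))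
    hcont.locallyIntegrable fun g g_smooth g_cpt => ?_
  have hg₁ : HasCompactSupport (Complex.ofRealCLM ∘ g) := g_cpt.comp_left rfl
  have hg₂ : ContDiff ℝ ((⊤ : ℕ∞) : WithTop ℕ∞) (Complex.ofRealCLM ∘ g) := by fun_prop
  set ψ : 𝓢(R3, ℂ) := hg₁.toSchwartzMap hg₂ with hψ
  have hψg : ∀ y, ψ y = (g y : ℂ) := fun y => rfl
  have h1 := congrArg (fun T => T ψ) (Lp.fourier_toTemperedDistribution_eq (hf2.toLp f))
  simp only [TemperedDistribution.fourier_apply, Lp.toTemperedDistribution_apply] at h1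
  have h2 := VectorFourier.integral_fourierIntegral_smul_eq_flip (L := innerₗ R3)
    (μ := (volume : Measure R3)) (ν := (volume : Measure R3)) Real.continuous_fourierChar
    continuous_inner hf1 ψ.integrable
  have h3 : ∫ y, (𝓕 f y) • ψ y = ∫ k, f k • (𝓕 ψ : 𝓢(R3, ℂ)) k := by
    refine h2.trans ?_
    rw [flip_innerₗ]
    rfl
  calc ∫ y, g y • (𝓕 (hf2.toLp f) : Lp ℂ 2 (volume : Measure R3)) y
      = ∫ y, ψ y • (𝓕 (hf2.toLp f) : Lp ℂ 2 (volume : Measure R3)) y := rfl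
    _ = ∫ k, (𝓕 ψ : 𝓢(R3, ℂ)) k • hf2.toLp f k := h1.symm
    _ = ∫ k, f k • (𝓕 ψ : 𝓢(R3, ℂ)) k := by
        refine integral_congr_ae ?_
        filter_upwards [hf2.coeFn_toLp] with k hk
        rw [hk, smul_eq_mul, smul_eq_mul, mul_comm]
    _ = ∫ y, g y • 𝓕 f y := by
        rw [← h3]
        refine integral_congr_ae (Filter.Eventually.of_forall fun y => ?_)
        simp only [hψg, smul_eq_mul, Complex.real_smul, mul_comm]

open FourierTransform in
/-- The Plancherel theorem for functions in `L¹ ∩ L²`. -/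
lemma fourier_memLp_two {f : R3 → ℂ} (hf1 : Integrable f) (hf2 : MemLp f 2) :
    MemLp (𝓕 f) 2 ∧ ∫ y, ‖𝓕 f y‖ ^ 2 = ∫ k, ‖f k‖ ^ 2 := by
  have h := toLp_fourier_ae_eq hf1 hf2
  have hsq : ∀ g : Lp ℂ 2 (volume : Measure R3), ∫ y, ‖g y‖ ^ 2 = ‖g‖ ^ 2 := by
    intro g
    have h1 := L2.inner_def (𝕜 := ℂ) g g
    rw [inner_self_eq_norm_sq_to_K] at h1
    have h2 : ∀ y, inner ℂ (g y) (g y) = ((‖g y‖ ^ 2 : ℝ) : ℂ) := fun y => by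
      rw [inner_self_eq_norm_sq_to_K]; simp
    simp only [h2] at h1
    rw [integral_complex_ofReal] at h1
    refine Complex.ofReal_injective (h1.symm.trans ?_)
    simp
  refine ⟨(memLp_congr_ae h).mp (Lp.memLp _), ?_⟩
  calc ∫ y, ‖𝓕 f y‖ ^ 2 = ∫ y, ‖(𝓕 (hf2.toLp f) : Lp ℂ 2 (volume : Measure R3)) y‖ ^ 2 := by
        refine integral_congr_ae ?_
        filter_upwards [h] with y hy
        rw [hy]
    _ = ∫ k, ‖hf2.toLp f k‖ ^ 2 := by rw [hsq, hsq, Lp.norm_fourier_eq]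
    _ = ∫ k, ‖f k‖ ^ 2 := by
        refine integral_congr_ae ?_
        filter_upwards [hf2.coeFn_toLp] with k hk
        rw [hk]

/-- The inverse Fourier transform `(2π)⁻³ ∫ G(k) e^{i k·y} dk`, in the convention without `2π` in
the exponent. -/
def invFourier (G : R3 → ℂ) (y : R3) : ℂ :=
  (((2 * Real.pi) ^ 3 : ℝ) : ℂ)⁻¹ *
    ∫ k : R3, G k * Complex.exp (Complex.I * ((inner ℝ k y : ℝ) : ℂ))

open FourierTransform in
lemma invFourier_eq (G : R3 → ℂ) (y : R3) :
    invFourier G y = (((2 * Real.pi) ^ 3 : ℝ) : ℂ)⁻¹ * 𝓕 G (-(2 * Real.pi)⁻¹ • y) := by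
  rw [invFourier, Real.fourier_eq']
  congr 1
  refine integral_congr_ae (Filter.Eventually.of_forall fun k => ?_)
  have hpi : (Real.pi : ℂ) ≠ 0 := by exact_mod_cast Real.pi_ne_zero
  simp only [inner_smul_right, smul_eq_mul]
  rw [mul_comm]
  congr 2
  push_cast
  field_simp

open FourierTransform in
lemma contDiff_invFourier {G : R3 → ℂ} (h0 : Integrable G) (h1 : Integrable fun k => ‖k‖ * ‖G k‖) :
    ContDiff ℝ 1 (invFourier G) := by
  have h : ContDiff ℝ 1 (𝓕 G) := by
    refine Real.contDiff_fourier (N := 1) fun n hn => ?_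
    have hn' : n ≤ 1 := by exact_mod_cast hn
    interval_cases n
    · simpa using h0.norm
    · simpa using h1
  have e : invFourier G = fun y =>
      (((2 * Real.pi) ^ 3 : ℝ) : ℂ)⁻¹ * 𝓕 G (-(2 * Real.pi)⁻¹ • y) := funext (invFourier_eq G)
  rw [e]
  exact contDiff_const.mul (h.comp (contDiff_const_smul _))

open FourierTransform in
lemma fderiv_invFourier {G : R3 → ℂ} (h0 : Integrable G) (h1 : Integrable fun k => ‖k‖ * ‖G k‖)
    (y v : R3) : fderiv ℝ (invFourier G) y v =
      invFourier (fun k => Complex.I * ((inner ℝ k v : ℝ) : ℂ) * G k) y := by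
  have e : invFourier G = fun y =>
      (((2 * Real.pi) ^ 3 : ℝ) : ℂ)⁻¹ * 𝓕 G (-(2 * Real.pi)⁻¹ • y) := funext (invFourier_eq G)
  have hd := Real.hasFDerivAt_fourier h0 h1 (-(2 * Real.pi)⁻¹ • y)
  have hl : HasFDerivAt (fun y : R3 => -(2 * Real.pi)⁻¹ • y)
      (-(2 * Real.pi)⁻¹ • ContinuousLinearMap.id ℝ R3) y :=
    (-(2 * Real.pi)⁻¹ • ContinuousLinearMap.id ℝ R3).hasFDerivAt
  have hc : HasFDerivAt (fun y =>
      (((2 * Real.pi) ^ 3 : ℝ) : ℂ)⁻¹ * 𝓕 G (-(2 * Real.pi)⁻¹ • y)) _ y :=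
    (hd.comp y hl).const_mul (((2 * Real.pi) ^ 3 : ℝ) : ℂ)⁻¹
  have hint : Integrable (VectorFourier.fourierSMulRight (innerSL ℝ) G) := by
    refine (h1.const_mul (2 * Real.pi * ‖innerSL ℝ (E := R3)‖)).mono'
      h0.1.fourierSMulRight (Filter.Eventually.of_forall fun k => ?_)
    exact (VectorFourier.norm_fourierSMulRight_le _ G k).trans (by rw [mul_assoc])
  rw [e, HasFDerivAt.fderiv hc, invFourier_eq]
  simp only [smul_apply, ContinuousLinearMap.comp_apply,
    ContinuousLinearMap.id_apply, smul_eq_mul]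
  have hfun : (fun k => VectorFourier.fourierSMulRight (innerSL ℝ) G k (-(2 * Real.pi)⁻¹ • v)) =
      fun k => Complex.I * ((inner ℝ k v : ℝ) : ℂ) * G k := by
    funext k
    have hpi : (Real.pi : ℂ) ≠ 0 := by exact_mod_cast Real.pi_ne_zero
    rw [VectorFourier.fourierSMulRight_apply]
    have hin : innerSL ℝ k (-(2 * Real.pi)⁻¹ • v) = -(2 * Real.pi)⁻¹ * inner ℝ k v :=
      inner_smul_right k v _
    rw [hin, Complex.real_smul, smul_eq_mul]
    push_cast
    field_simp
  rw [Real.fourier_continuousLinearMap_apply hint, hfun]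

lemma invFourier_memLp_two {G : R3 → ℂ} (h1 : Integrable G) (h2 : MemLp G 2) :
    MemLp (invFourier G) 2 ∧
      ∫ y, ‖invFourier G y‖ ^ 2 = ((2 * Real.pi) ^ 3)⁻¹ * ∫ k, ‖G k‖ ^ 2 := by
  obtain ⟨h3, h4⟩ := fourier_memLp_two h1 h2
  have hne : -(2 * Real.pi)⁻¹ ≠ 0 := by
    have := Real.pi_pos
    exact (neg_neg_of_pos (by positivity)).ne
  have hsq : ∀ y, ‖invFourier G y‖ ^ 2 = (((2 * Real.pi) ^ 3)⁻¹) ^ 2 *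
      (fun z => ‖FourierTransform.fourier G z‖ ^ 2) (-(2 * Real.pi)⁻¹ • y) := by
    intro y
    have := Real.pi_pos
    rw [invFourier_eq, norm_mul, norm_inv, Complex.norm_real, mul_pow, Real.norm_of_nonneg
      (by positivity)]
  have hcont : Continuous (FourierTransform.fourier G) := VectorFourier.fourierIntegral_continuous
    Real.continuous_fourierChar continuous_inner h1
  constructor
  · have hc : Continuous (invFourier G) := by
      rw [funext (invFourier_eq G)]
      exact continuous_const.mul (hcont.comp (continuous_const_smul _))
    rw [memLp_two_iff_integrable_sq_norm hc.aestronglyMeasurable]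
    simp only [hsq]
    refine Integrable.const_mul ?_ _
    exact (integrable_comp_smul_iff volume (fun z => ‖FourierTransform.fourier G z‖ ^ 2) hne).mpr
      ((memLp_two_iff_integrable_sq_norm hcont.aestronglyMeasurable).mp h3)
  · simp only [hsq]
    rw [integral_const_mul]
    refine (congrArg (_ * ·) (Measure.integral_comp_smul volume
      (fun z => ‖FourierTransform.fourier G z‖ ^ 2) _)).trans ?_
    have := Real.pi_pos
    rw [h4, finrank_euclideanSpace_fin, smul_eq_mul, ← mul_assoc, abs_inv, abs_pow, abs_neg,
      abs_of_pos (by positivity)]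
    congr 1
    field_simp

lemma invFourier_im {G : R3 → ℂ} (h : ∀ k, G (-k) = starRingEnd ℂ (G k)) (y : R3) :
    (invFourier G y).im = 0 := by
  rw [← Complex.conj_eq_iff_im, invFourier, map_mul, ← integral_conj, map_inv₀, Complex.conj_ofReal]
  congr 1
  rw [← integral_neg_eq_self]
  refine integral_congr_ae (Filter.Eventually.of_forall fun k => ?_)
  simp only [h, map_mul, Complex.conj_conj, ← Complex.exp_conj, Complex.conj_I,
    inner_neg_left, Complex.conj_ofReal]
  simp

lemma integrable_mul_exp {G : R3 → ℂ} (hG : Integrable G) (y : R3) :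
    Integrable fun k => G k * Complex.exp (Complex.I * ((inner ℝ k y : ℝ) : ℂ)) := by
  refine hG.mul_bdd (c := 1) (Continuous.aestronglyMeasurable (by fun_prop))
    (Filter.Eventually.of_forall fun k => ?_)
  rw [mul_comm, Complex.norm_exp_ofReal_mul_I]

lemma invFourier_sum {ι : Type*} (s : Finset ι) {G : ι → R3 → ℂ} (hG : ∀ i ∈ s, Integrable (G i))
    (y : R3) : invFourier (fun k => ∑ i ∈ s, G i k) y = ∑ i ∈ s, invFourier (G i) y := by
  simp only [invFourier, Finset.sum_mul]
  rw [integral_finsetSum s fun i hi => integrable_mul_exp (hG i hi) y, Finset.mul_sum]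

lemma invFourier_sub {G G' : R3 → ℂ} (hG : Integrable G) (hG' : Integrable G') (y : R3) :
    invFourier (fun k => G k - G' k) y = invFourier G y - invFourier G' y := by
  simp only [invFourier, sub_mul]
  rw [integral_sub (integrable_mul_exp hG y) (integrable_mul_exp hG' y), mul_sub]

lemma invFourier_const_mul (c : ℂ) (G : R3 → ℂ) (y : R3) :
    invFourier (fun k => c * G k) y = c * invFourier G y := by
  simp only [invFourier, mul_assoc]
  rw [integral_const_mul, mul_left_comm]

lemma invFourier_translate (G : R3 → ℂ) (x y : R3) :
    invFourier (fun k => Complex.exp (-(Complex.I * ((inner ℝ k x : ℝ) : ℂ))) * G k) y =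
      invFourier G (y - x) := by
  simp only [invFourier]
  congr 1
  refine integral_congr_ae (Filter.Eventually.of_forall fun k => ?_)
  simp only [inner_sub_right, Complex.ofReal_sub, mul_sub, Complex.exp_sub, Complex.exp_neg]
  ring

/-! ### Uniqueness of the magnetic field -/

lemma hasDerivAt_apply_partialD {D : R3 → R3} {y : R3} (h : DifferentiableAt ℝ D y) (j i : Fin 3) :
    HasDerivAt (fun t : ℝ => D (y + t • e j) i) (partialD D j i y) 0 :=
  (EuclideanSpace.proj (𝕜 := ℝ) i).hasFDerivAt.comp_hasDerivAt (0 : ℝ)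
    (h.hasFDerivAt.hasLineDerivAt (e j))

lemma hasDerivAt_coord (y : R3) (j i : Fin 3) :
    HasDerivAt (fun t : ℝ => (y + t • e j) i) (if i = j then 1 else 0) 0 := by
  have h : (fun t : ℝ => (y + t • e j) i) = fun t => y i + t * (if i = j then 1 else 0) := by
    funext t
    simp [e]
  rw [h]
  exact (((hasDerivAt_id (0 : ℝ)).mul_const _).const_add (y i)).congr_deriv (one_mul _)

/-- The component `j` of the vector field `(D·y) D - ½ |D|² y`: the Maxwell stress tensor of `D`
applied to the generator `y` of dilations. -/
def virialFlux (D : R3 → R3) (j : Fin 3) (y : R3) : ℝ :=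
  (∑ i, D y i * y i) * D y j - (1 / 2) * (∑ i, D y i ^ 2) * y j

/-- The partial derivative `∂_j` of `virialFlux D j`. -/
def virialFluxDeriv (D : R3 → R3) (j : Fin 3) (y : R3) : ℝ :=
  (∑ i, (partialD D j i y * y i + D y i * (if i = j then 1 else 0))) * D y j +
    (∑ i, D y i * y i) * partialD D j j y -
    ((1 / 2) * (∑ i, 2 * D y i * partialD D j i y) * y j + (1 / 2) * (∑ i, D y i ^ 2))

lemma hasLineDerivAt_virialFlux {D : R3 → R3} (hD : Differentiable ℝ D) (j : Fin 3) (y : R3) :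
    HasLineDerivAt ℝ (virialFlux D j) (virialFluxDeriv D j y) y (e j) := by
  have hd := fun i => hasDerivAt_apply_partialD (hD y) j i
  have hc := fun i => hasDerivAt_coord y j i
  have h1 := HasDerivAt.fun_sum (u := Finset.univ) fun i _ => (hd i).mul (hc i)
  have h2 := HasDerivAt.fun_sum (u := Finset.univ) fun i _ => (hd i).fun_pow 2
  have h := (h1.mul (hd j)).sub ((h2.const_mul (1 / 2)).mul (hc j))
  refine HasDerivAt.congr_deriv (f := fun t : ℝ => virialFlux D j (y + t • e j)) h ?_
  simp [virialFluxDeriv]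

/-- For a field without divergence and curl, the divergence of the flux is `-½ |D|²`. -/
lemma sum_virialFluxDeriv {D : R3 → R3} {y : R3} (hdiv : divergence D y = 0)
    (hcurl : curl D y = 0) :
    ∑ j, virialFluxDeriv D j y = -(1 / 2) * ∑ i, D y i ^ 2 := by
  have c0 := congrArg (fun v : R3 => v 0) hcurl
  have c1 := congrArg (fun v : R3 => v 1) hcurl
  have c2 := congrArg (fun v : R3 => v 2) hcurl
  simp [curl] at c0 c1 c2
  rw [divergence, Fin.sum_univ_three] at hdiv
  simp only [virialFluxDeriv, Fin.sum_univ_three]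
  have e0 : partialD D 1 2 y = partialD D 2 1 y := by linarith
  have e1 : partialD D 2 0 y = partialD D 0 2 y := by linarith
  have e2 : partialD D 0 1 y = partialD D 1 0 y := by linarith
  have e3 : partialD D 0 0 y = -partialD D 1 1 y - partialD D 2 2 y := by linarith
  simp [e0, e1, e2, e3]
  ring

lemma continuous_partialD {D : R3 → R3} (hD : ContDiff ℝ 1 D) (i a : Fin 3) :
    Continuous (partialD D i a) :=
  (EuclideanSpace.proj (𝕜 := ℝ) a).continuous.comp
    ((hD.continuous_fderiv one_ne_zero).clm_apply continuous_const)

/-- The divergence theorem for the flux times a cutoff `χ`. -/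
lemma virial_identity {D : R3 → R3} (hD : ContDiff ℝ 1 D) (hdiv : ∀ y, divergence D y = 0)
    (hcurl : ∀ y, curl D y = 0) {χ : R3 → ℝ} (hχ : ContDiff ℝ 1 χ) (hs : HasCompactSupport χ) :
    ∫ y, ∑ j, virialFlux D j y * fderiv ℝ χ y (e j) =
      (1 / 2) * ∫ y, (∑ i, D y i ^ 2) * χ y := by
  have hDc : ∀ i, Continuous fun y => D y i := fun i =>
    (EuclideanSpace.proj (𝕜 := ℝ) i).continuous.comp hD.continuous
  have hyc : ∀ i, Continuous fun y : R3 => y i := fun i =>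
    (EuclideanSpace.proj (𝕜 := ℝ) i).continuous
  have hp := fun i a => continuous_partialD hD i a
  have hF : ∀ j, Continuous (virialFlux D j) := fun j => by unfold virialFlux; fun_prop
  have hF' : ∀ j, Continuous (virialFluxDeriv D j) := fun j => by unfold virialFluxDeriv; fun_prop
  have hχ' : ∀ j, Continuous fun y => fderiv ℝ χ y (e j) := fun j =>
    (hχ.continuous_fderiv one_ne_zero).clm_apply continuous_const
  have hs' : ∀ j, HasCompactSupport fun y => fderiv ℝ χ y (e j) := fun j => hs.fderiv_apply ℝ (e j)
  have i1 : ∀ j, Integrable fun y => virialFlux D j y * fderiv ℝ χ y (e j) := fun j =>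
    ((hF j).mul (hχ' j)).integrable_of_hasCompactSupport ((hs' j).mul_left)
  have i2 : ∀ j, Integrable fun y => virialFluxDeriv D j y * χ y := fun j =>
    ((hF' j).mul hχ.continuous).integrable_of_hasCompactSupport hs.mul_left
  have h : ∀ j, ∫ y, virialFlux D j y * fderiv ℝ χ y (e j) = -∫ y, virialFluxDeriv D j y * χ y := by
    intro j
    exact integral_bilinear_hasLineDerivAt_right_eq_neg_left_of_integrable
      (B := ContinuousLinearMap.mul ℝ ℝ) (i2 j) (i1 j)
      (((hF j).mul hχ.continuous).integrable_of_hasCompactSupport hs.mul_left)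
      (fun y _ => hasLineDerivAt_virialFlux (hD.differentiable one_ne_zero) j y)
      (fun y _ => (hχ.differentiable one_ne_zero y).hasFDerivAt.hasLineDerivAt (e j))
  rw [integral_finsetSum _ fun j _ => i1 j]
  simp only [h]
  rw [Finset.sum_neg_distrib, ← integral_finsetSum _ fun j _ => i2 j, ← integral_const_mul,
    ← integral_neg]
  refine integral_congr_ae (Filter.Eventually.of_forall fun y => ?_)
  simp only [← Finset.sum_mul, sum_virialFluxDeriv (hdiv y) (hcurl y)]
  ring

lemma abs_virialFlux_le (D : R3 → R3) (j : Fin 3) (y : R3) :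
    |virialFlux D j y| ≤ 2 * ‖D y‖ ^ 2 * ‖y‖ := by
  have h1 : ∑ i, D y i * y i = inner ℝ (D y) y := by
    simp [PiLp.inner_apply, mul_comm]
  have h2 : ∑ i, D y i ^ 2 = ‖D y‖ ^ 2 := by rw [EuclideanSpace.norm_sq_eq]; simp
  rw [virialFlux, h1, h2]
  have h3 := abs_real_inner_le_norm (D y) y
  have h4 := abs_apply_le (D y) j
  have h5 := abs_apply_le y j
  have h6 : |inner ℝ (D y) y * D y j| ≤ ‖D y‖ * ‖y‖ * ‖D y‖ := by
    rw [abs_mul]; gcongr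
  have h7 : |1 / 2 * ‖D y‖ ^ 2 * y j| ≤ 1 / 2 * ‖D y‖ ^ 2 * ‖y‖ := by
    rw [abs_mul, abs_of_nonneg (by positivity : 0 ≤ 1 / 2 * ‖D y‖ ^ 2)]; gcongr
  calc _ ≤ |inner ℝ (D y) y * D y j| + |1 / 2 * ‖D y‖ ^ 2 * y j| := abs_sub _ _
    _ ≤ 2 * ‖D y‖ ^ 2 * ‖y‖ := by nlinarith [mul_nonneg (sq_nonneg ‖D y‖) (norm_nonneg y)]

/-- A square integrable field without divergence and curl vanishes. In the virial identity for the
rescaled cutoffs `χ(y/(n+1))` the term with `∇χ` is dominated by `|D|²`, and tends to `0` pointwise,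
while the other term tends to the energy `½ ∫ |D|²`. -/
lemma eq_zero_of_divergence_curl_eq_zero {D : R3 → R3} (hD : ContDiff ℝ 1 D) (hL : MemLp D 2 volume)
    (hdiv : ∀ y, divergence D y = 0) (hcurl : ∀ y, curl D y = 0) : D = 0 := by
  let χ : ContDiffBump (0 : R3) := ⟨1, 2, one_pos, one_lt_two⟩
  have hχ : ContDiff ℝ 1 χ := χ.contDiff
  have hq : Integrable fun y => ‖D y‖ ^ 2 := (memLp_two_iff_integrable_sq_norm hL.1).mp hL
  have hsq : ∀ y, ∑ i, D y i ^ 2 = ‖D y‖ ^ 2 := fun y => by rw [EuclideanSpace.norm_sq_eq]; simp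
  set r : ℕ → ℝ := fun n => ((n : ℝ) + 1)⁻¹ with hr
  have hr0 : ∀ n, 0 < r n := fun n => by positivity
  have hrlim : Filter.Tendsto r Filter.atTop (nhds 0) := tendsto_inv_atTop_zero.comp
    (Filter.tendsto_atTop_add_const_right _ _ tendsto_natCast_atTop_atTop)
  have hylim : ∀ y : R3, Filter.Tendsto (fun n => r n • y) Filter.atTop (nhds 0) := fun y => by
    simpa using hrlim.smul_const y
  have hone : ∀ y : R3, ∀ᶠ n in Filter.atTop, χ =ᶠ[nhds (r n • y)] fun _ => 1 := by
    intro y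
    filter_upwards [(hylim y).eventually (Metric.ball_mem_nhds 0 one_pos)] with n hn
    exact χ.eventuallyEq_one_of_mem_ball hn
  set X : ℕ → R3 → ℝ := fun n y => χ (r n • y) with hX
  have hXc : ∀ n, ContDiff ℝ 1 (X n) := fun n => hχ.comp (contDiff_const_smul _)
  have hXs : ∀ n, HasCompactSupport (X n) := fun n => χ.hasCompactSupport.comp_smul (hr0 n).ne'
  have hXd : ∀ n y j, fderiv ℝ (X n) y (e j) = r n * fderiv ℝ χ (r n • y) (e j) := by
    intro n y j
    have h := ((hχ.differentiable one_ne_zero (r n • y)).hasFDerivAt.comp y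
      (r n • ContinuousLinearMap.id ℝ R3).hasFDerivAt)
    have h' : HasFDerivAt (X n) _ y := h
    rw [h'.fderiv]
    simp
  obtain ⟨C, hC⟩ : ∃ C, ∀ z : R3, ‖‖z‖ * ‖fderiv ℝ χ z‖‖ ≤ C := by
    refine (Continuous.mul continuous_norm
      (hχ.continuous_fderiv one_ne_zero).norm).bounded_above_of_compact_support ?_
    exact (χ.hasCompactSupport.fderiv ℝ).norm.mul_left
  have hid := fun n => virial_identity hD hdiv hcurl (hXc n) (hXs n)
  have hDm : AEStronglyMeasurable (fun y => ‖D y‖ ^ 2) volume := hq.1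
  have hlim1 : Filter.Tendsto (fun n => ∫ y, ∑ j, virialFlux D j y * fderiv ℝ (X n) y (e j))
      Filter.atTop (nhds (∫ _ : R3, (0 : ℝ))) := by
    refine tendsto_integral_of_dominated_convergence (fun y => 6 * C * ‖D y‖ ^ 2) (fun n => ?_)
      (hq.const_mul _) (fun n => Filter.Eventually.of_forall fun y => ?_)
      (Filter.Eventually.of_forall fun y => ?_)
    · have hDc : ∀ i, Continuous fun y => D y i := fun i =>
        (EuclideanSpace.proj (𝕜 := ℝ) i).continuous.comp hD.continuous
      have hyc : ∀ i, Continuous fun y : R3 => y i := fun i =>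
        (EuclideanSpace.proj (𝕜 := ℝ) i).continuous
      have hF : ∀ j, Continuous (virialFlux D j) := fun j => by unfold virialFlux; fun_prop
      exact (continuous_finsetSum _ fun j _ => (hF j).mul
        (((hXc n).continuous_fderiv one_ne_zero).clm_apply continuous_const)).aestronglyMeasurable
    · have hj : ∀ j ∈ Finset.univ, ‖virialFlux D j y * fderiv ℝ (X n) y (e j)‖ ≤
          2 * C * ‖D y‖ ^ 2 := by
        intro j _
        have he : ‖(e j : R3)‖ = 1 := by simp [e]
        have h1 : |fderiv ℝ χ (r n • y) (e j)| ≤ ‖fderiv ℝ χ (r n • y)‖ := by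
          simpa [he] using (fderiv ℝ χ (r n • y)).le_opNorm (e j)
        have h2 := hC (r n • y)
        rw [norm_mul, norm_norm, norm_norm, norm_smul, Real.norm_of_nonneg (hr0 n).le] at h2
        rw [hXd, Real.norm_eq_abs, abs_mul, abs_mul, abs_of_pos (hr0 n)]
        calc |virialFlux D j y| * (r n * |fderiv ℝ χ (r n • y) (e j)|)
            ≤ 2 * ‖D y‖ ^ 2 * ‖y‖ * (r n * ‖fderiv ℝ χ (r n • y)‖) := by
              gcongr
              exact abs_virialFlux_le D j y
          _ = 2 * ‖D y‖ ^ 2 * (r n * ‖y‖ * ‖fderiv ℝ χ (r n • y)‖) := by ring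
          _ ≤ 2 * ‖D y‖ ^ 2 * C := by gcongr
          _ = 2 * C * ‖D y‖ ^ 2 := by ring
      refine (norm_sum_le_of_le _ hj).trans (le_of_eq ?_)
      simp
      ring
    · refine tendsto_const_nhds.congr' ?_
      filter_upwards [hone y] with n hn
      simp [hXd, hn.fderiv_eq]
  have hlim2 : Filter.Tendsto (fun n => ∫ y, (∑ i, D y i ^ 2) * X n y)
      Filter.atTop (nhds (∫ y, ‖D y‖ ^ 2)) := by
    refine tendsto_integral_of_dominated_convergence (fun y => ‖D y‖ ^ 2) (fun n => ?_)
      hq (fun n => Filter.Eventually.of_forall fun y => ?_)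
      (Filter.Eventually.of_forall fun y => ?_)
    · simp only [hsq]
      exact hDm.mul (hXc n).continuous.aestronglyMeasurable
    · rw [hsq, norm_mul, Real.norm_of_nonneg (sq_nonneg ‖D y‖), Real.norm_of_nonneg χ.nonneg]
      exact mul_le_of_le_one_right (sq_nonneg _) χ.le_one
    · refine tendsto_const_nhds.congr' ?_
      filter_upwards [hone y] with n hn
      simp [hX, hn.eq_of_nhds, hsq]
  have h0 : ∫ y, ‖D y‖ ^ 2 = 0 := by
    have h1 := tendsto_nhds_unique hlim1 (by simpa only [hid] using hlim2.const_mul (1 / 2))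
    simpa using h1
  have h1 := (integral_eq_zero_iff_of_nonneg (fun y => sq_nonneg ‖D y‖) hq).mp h0
  refine Continuous.ae_eq_iff_eq volume hD.continuous continuous_const |>.mp ?_
  filter_upwards [h1] with y hy
  simpa using hy

lemma IsMagneticField.unique {j B B' : R3 → R3} (h : IsMagneticField j B)
    (h' : IsMagneticField j B') : B = B' := by
  have hp : ∀ i a y, partialD (B - B') i a y = partialD B i a y - partialD B' i a y := by
    intro i a y
    rw [partialD, fderiv_sub (h.contDiff.differentiable one_ne_zero y)
      (h'.contDiff.differentiable one_ne_zero y)]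
    rfl
  refine sub_eq_zero.mp (eq_zero_of_divergence_curl_eq_zero (h.contDiff.sub h'.contDiff)
    (h.memLp.sub h'.memLp) (fun y => ?_) fun y => ?_)
  · have h1 := h.divergence_eq y
    have h2 := h'.divergence_eq y
    rw [divergence] at h1 h2 ⊢
    simp only [hp, Finset.sum_sub_distrib, h1, h2, sub_zero]
  · have h1 := (h.curl_eq y).trans (h'.curl_eq y).symm
    have h2 : curl (B - B') y = curl B y - curl B' y := by
      refine PiLp.ext fun a => ?_
      fin_cases a <;> simp [curl, hp] <;> ring
    rw [h2, h1, sub_self]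

/-! ### The transverse coefficients -/

lemma transverseMatrix_neg (j m : Fin 3) (k : R3) :
    transverseMatrix j m (-k) = transverseMatrix j m k := by
  simp [transverseMatrix]

lemma abs_transverseMatrix_le (j m : Fin 3) (k : R3) : |transverseMatrix j m k| ≤ 2 := by
  rw [transverseMatrix, abs_div, abs_of_nonneg (sq_nonneg ‖k‖)]
  refine div_le_of_le_mul₀ (sq_nonneg _) zero_le_two ?_
  have h1 : |if j = m then ‖k‖ ^ 2 else 0| ≤ ‖k‖ ^ 2 := by
    split_ifs
    · rw [abs_of_nonneg (sq_nonneg ‖k‖)]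
    · simp
  have h2 : |k j * k m| ≤ ‖k‖ ^ 2 := by
    rw [abs_mul, sq]
    exact mul_le_mul (abs_apply_le k j) (abs_apply_le k m) (abs_nonneg _) (norm_nonneg _)
  exact (abs_sub _ _).trans (by linarith)

lemma measurable_apply (a : Fin 3) : Measurable fun k : R3 => k a :=
  (EuclideanSpace.proj (𝕜 := ℝ) a).continuous.measurable

lemma measurable_transverseMatrix (j m : Fin 3) : Measurable (transverseMatrix j m) := by
  have h1 := measurable_apply j
  have h2 := measurable_apply m
  unfold transverseMatrix
  split_ifs <;> fun_prop

/-- The matrix is a symmetric projection (the zero matrix, if `k = 0`). -/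
lemma sum_transverseMatrix_mul (m m' : Fin 3) (k : R3) :
    ∑ a, transverseMatrix a m k * transverseMatrix a m' k = transverseMatrix m m' k := by
  rcases eq_or_ne k 0 with rfl | hk
  · simp [transverseMatrix]
  have hn : ‖k‖ ^ 2 ≠ 0 := pow_ne_zero 2 (norm_ne_zero_iff.mpr hk)
  have hs : ‖k‖ ^ 2 = k 0 ^ 2 + k 1 ^ 2 + k 2 ^ 2 := by
    rw [EuclideanSpace.norm_sq_eq, Fin.sum_univ_three]; simp
  simp only [transverseMatrix, div_mul_div_comm, ← Finset.sum_div]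
  rw [div_eq_div_iff (mul_ne_zero hn hn) hn, hs]
  fin_cases m <;> fin_cases m' <;> simp [Fin.sum_univ_three] <;> ring

lemma sum_mul_transverseMatrix (m : Fin 3) (k : R3) : ∑ a, k a * transverseMatrix a m k = 0 := by
  have hs : ‖k‖ ^ 2 = k 0 ^ 2 + k 1 ^ 2 + k 2 ^ 2 := by
    rw [EuclideanSpace.norm_sq_eq, Fin.sum_univ_three]; simp
  simp only [transverseMatrix, mul_div_assoc', ← Finset.sum_div]
  rw [hs]
  refine div_eq_zero_iff.mpr (Or.inl ?_)
  fin_cases m <;> simp [Fin.sum_univ_three] <;> ring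

/-- The longitudinal part does not contribute to the cross product with `k`. -/
lemma mul_transverseMatrix_sub (a b m : Fin 3) (k : R3) :
    k a * transverseMatrix b m k - k b * transverseMatrix a m k =
      k a * (if b = m then 1 else 0) - k b * (if a = m then 1 else 0) := by
  rcases eq_or_ne k 0 with rfl | hk
  · simp
  have hn : ‖k‖ ≠ 0 := norm_ne_zero_iff.mpr hk
  simp only [transverseMatrix]
  split_ifs <;> field_simp <;> ring

lemma integrable_transverseCoeff (φ : 𝓢(ℝ, ℝ)) (j m : Fin 3) (x : R3) :
    Integrable fun k : R3 => ((|φ ‖k‖| ^ 2 : ℝ) : ℂ) *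
      Complex.exp (-(Complex.I * ((inner ℝ k x : ℝ) : ℂ))) * (transverseMatrix j m k : ℂ) := by
  have h1 := measurable_comp_norm φ
  have h2 := measurable_transverseMatrix j m
  refine ((integrable_sq_norm φ).mul_const 2).mono' (Measurable.aestronglyMeasurable (by fun_prop))
    (Filter.Eventually.of_forall fun k => ?_)
  rw [norm_mul, norm_mul, norm_exp_neg_I_mul, mul_one, Complex.norm_real, Complex.norm_real,
    Real.norm_of_nonneg (by positivity), sq_abs]
  exact mul_le_mul_of_nonneg_left (abs_transverseMatrix_le j m k) (sq_nonneg _)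

lemma conj_transverseCoeff (φ : 𝓢(ℝ, ℝ)) (j m : Fin 3) (x : R3) :
    starRingEnd ℂ (transverseCoeff φ j m x) = transverseCoeff φ j m x := by
  rw [transverseCoeff, map_mul, ← integral_conj, map_inv₀, Complex.conj_ofReal]
  congr 1
  rw [← integral_neg_eq_self]
  refine integral_congr_ae (Filter.Eventually.of_forall fun k => ?_)
  simp only [norm_neg, inner_neg_left, PiLp.neg_apply, neg_mul_neg, map_mul, ← Complex.exp_conj,
    Complex.conj_I, Complex.conj_ofReal, Complex.ofReal_neg, map_neg]

/-- The coefficients at the origin inherit the symmetries of the transverse projection, since the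
cutoff is radial. -/
lemma transverseCoeff_zero_eq_mul (φ : 𝓢(ℝ, ℝ)) {j m j' m' : Fin 3} {c : ℝ} (L : R3 ≃ₗᵢ[ℝ] R3)
    (h : ∀ k, transverseMatrix j m (L k) = c * transverseMatrix j' m' k) :
    transverseCoeff φ j m 0 = c * transverseCoeff φ j' m' 0 := by
  have h1 := L.measurePreserving.integral_comp L.toHomeomorph.measurableEmbedding
    fun k => ((|φ ‖k‖| ^ 2 : ℝ) : ℂ) * Complex.exp (-(Complex.I * ((inner ℝ k 0 : ℝ) : ℂ))) *
      (transverseMatrix j m k : ℂ)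
  rw [transverseCoeff, transverseCoeff, mul_left_comm]
  congr 1
  refine h1.symm.trans ?_
  rw [← integral_const_mul]
  refine integral_congr_ae (Filter.Eventually.of_forall fun k => ?_)
  simp only [h, L.norm_map, inner_zero_right, Complex.ofReal_mul]
  rw [transverseMatrix]
  ring

/-- At the origin, reflections of one coordinate remove the entries off the diagonal, and exchanges
of two coordinates make the diagonal constant. -/
lemma transverseCoeff_zero (φ : 𝓢(ℝ, ℝ)) (j m : Fin 3) :
    transverseCoeff φ j m 0 = if j = m then transverseCoeff φ 0 0 0 else 0 := by
  split_ifs with h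
  · subst h
    let L : R3 ≃ₗᵢ[ℝ] R3 := LinearIsometryEquiv.piLpCongrLeft 2 ℝ ℝ (Equiv.swap j 0)
    have hL := transverseCoeff_zero_eq_mul φ (j := j) (m := j) (j' := 0) (m' := 0) (c := 1) L
      fun k => by
        have hk : L k j = k 0 := by simp [L, LinearIsometryEquiv.piLpCongrLeft_apply]
        simp [transverseMatrix, L.norm_map, hk]
    simpa using hL
  · let L : R3 ≃ₗᵢ[ℝ] R3 := LinearIsometryEquiv.piLpCongrRight 2 fun i : Fin 3 =>
      if i = j then LinearIsometryEquiv.neg ℝ else LinearIsometryEquiv.refl ℝ ℝ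
    have hL := transverseCoeff_zero_eq_mul φ (j := j) (m := m) (j' := j) (m' := m) (c := -1) L
      fun k => by
        have hk : L k j = -k j := by simp [L]
        have hk' : L k m = k m := by simp [L, Ne.symm h]
        simp only [transverseMatrix, L.norm_map, hk, hk', if_neg h]
        ring
    have h2 : transverseCoeff φ j m 0 = -transverseCoeff φ j m 0 := by simpa using hL
    exact self_eq_neg.mp h2

/-! ### The field of smeared out dipoles -/

section

variable {P : ℕ}

/-- The component `a` of the Fourier transform of the magnetic field of point dipoles with moments
`M^{[l]} S^{[l]}` at the positions `x^{[l]}`, smeared out by `ρ`: the transverse part of the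
magnetisation. -/
def dipoleFourier (φ : 𝓢(ℝ, ℝ)) (x : Fin P → R3) (M : Fin P → ℝ) (S : Fin P → R3) (a : Fin 3)
    (k : R3) : ℂ :=
  ∑ i : Fin P × Fin 3, ((M i.1 * S i.1 i.2 : ℝ) : ℂ) *
    (Complex.exp (-(Complex.I * ((inner ℝ k (x i.1) : ℝ) : ℂ))) *
      ((φ ‖k‖ * transverseMatrix a i.2 k : ℝ) : ℂ))

/-- The magnetic field of smeared out point dipoles. The real part only changes the type: the
inverse Fourier transform is real by `dipoleFourier_neg`. -/
def dipoleField (φ : 𝓢(ℝ, ℝ)) (x : Fin P → R3) (M : Fin P → ℝ) (S : Fin P → R3) (y : R3) : R3 :=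
  WithLp.toLp 2 fun a => (invFourier (dipoleFourier φ x M S a) y).re

section

variable (φ : 𝓢(ℝ, ℝ)) (x : Fin P → R3) (M : Fin P → ℝ) (S : Fin P → R3)

lemma measurable_dipoleFourier (a : Fin 3) : Measurable (dipoleFourier φ x M S a) := by
  have h1 := measurable_comp_norm φ
  have h2 := measurable_transverseMatrix a
  unfold dipoleFourier
  fun_prop

lemma exists_norm_dipoleFourier_le (a : Fin 3) :
    ∃ C, ∀ k, ‖dipoleFourier φ x M S a k‖ ≤ C * |φ ‖k‖| := by
  refine ⟨∑ i : Fin P × Fin 3, |M i.1 * S i.1 i.2| * 2, fun k => ?_⟩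
  rw [Finset.sum_mul]
  refine norm_sum_le_of_le _ fun i _ => ?_
  rw [norm_mul, norm_mul, norm_exp_neg_I_mul, one_mul, Complex.norm_real, Complex.norm_real,
    Real.norm_eq_abs, Real.norm_eq_abs, abs_mul (φ ‖k‖), mul_assoc, mul_comm 2]
  gcongr
  exact abs_transverseMatrix_le a i.2 k

lemma integrable_dipoleFourier (a : Fin 3) : Integrable (dipoleFourier φ x M S a) := by
  obtain ⟨C, hC⟩ := exists_norm_dipoleFourier_le φ x M S a
  refine ((integrable_pow_mul_abs_norm φ 0).const_mul C).mono'
    (measurable_dipoleFourier φ x M S a).aestronglyMeasurable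
    (Filter.Eventually.of_forall fun k => ?_)
  simpa using hC k

lemma integrable_norm_mul_dipoleFourier (a : Fin 3) :
    Integrable fun k => ‖k‖ * ‖dipoleFourier φ x M S a k‖ := by
  obtain ⟨C, hC⟩ := exists_norm_dipoleFourier_le φ x M S a
  refine ((integrable_pow_mul_abs_norm φ 1).const_mul C).mono'
    (measurable_norm.mul (measurable_dipoleFourier φ x M S a).norm).aestronglyMeasurable
    (Filter.Eventually.of_forall fun k => ?_)
  rw [norm_mul, norm_norm, norm_norm, pow_one, mul_left_comm]
  exact mul_le_mul_of_nonneg_left (hC k) (norm_nonneg k)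

lemma memLp_dipoleFourier (a : Fin 3) : MemLp (dipoleFourier φ x M S a) 2 := by
  have hm := measurable_dipoleFourier φ x M S a
  obtain ⟨C, hC⟩ := exists_norm_dipoleFourier_le φ x M S a
  rw [memLp_two_iff_integrable_sq_norm hm.aestronglyMeasurable]
  refine ((integrable_sq_norm φ).const_mul (C ^ 2)).mono'
    (hm.norm.pow_const 2).aestronglyMeasurable (Filter.Eventually.of_forall fun k => ?_)
  rw [norm_pow, norm_norm, ← sq_abs (φ ‖k‖), ← mul_pow]
  exact pow_le_pow_left₀ (norm_nonneg _) (hC k) 2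

/-- The reality condition, by which the inverse Fourier transform is a real field. -/
lemma dipoleFourier_neg (a : Fin 3) (k : R3) :
    dipoleFourier φ x M S a (-k) = starRingEnd ℂ (dipoleFourier φ x M S a k) := by
  simp only [dipoleFourier, map_sum, map_mul, Complex.conj_ofReal, ← Complex.exp_conj, map_neg,
    Complex.conj_I, inner_neg_left, norm_neg, transverseMatrix_neg, Complex.ofReal_neg,
    neg_mul, mul_neg]

lemma ofReal_dipoleField (y : R3) (a : Fin 3) :
    ((dipoleField φ x M S y a : ℝ) : ℂ) = invFourier (dipoleFourier φ x M S a) y := by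
  refine Complex.ext rfl ?_
  rw [invFourier_im (dipoleFourier_neg φ x M S a), Complex.ofReal_im]

lemma contDiff_dipoleField : ContDiff ℝ 1 (dipoleField φ x M S) := by
  rw [contDiff_euclidean]
  intro a
  exact Complex.reCLM.contDiff.comp (contDiff_invFourier (integrable_dipoleFourier φ x M S a)
    (integrable_norm_mul_dipoleFourier φ x M S a))

lemma norm_sq_dipoleField (y : R3) :
    ‖dipoleField φ x M S y‖ ^ 2 = ∑ a, ‖invFourier (dipoleFourier φ x M S a) y‖ ^ 2 := by
  rw [EuclideanSpace.norm_sq_eq]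
  refine Finset.sum_congr rfl fun a _ => ?_
  rw [← ofReal_dipoleField, Complex.norm_real]

lemma memLp_dipoleField : MemLp (dipoleField φ x M S) 2 := by
  rw [memLp_two_iff_integrable_sq_norm
    (contDiff_dipoleField φ x M S).continuous.aestronglyMeasurable]
  simp only [norm_sq_dipoleField]
  refine integrable_finsetSum _ fun a _ => ?_
  have h := (invFourier_memLp_two (integrable_dipoleFourier φ x M S a)
    (memLp_dipoleFourier φ x M S a)).1
  exact (memLp_two_iff_integrable_sq_norm h.1).mp h

lemma inner_e (k : R3) (a : Fin 3) : inner ℝ k (e a) = k a := by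
  simp [e, EuclideanSpace.inner_single_right]

lemma partialD_dipoleField (i a : Fin 3) (y : R3) :
    partialD (dipoleField φ x M S) i a y =
      (invFourier (fun k => Complex.I * (k i : ℂ) * dipoleFourier φ x M S a k) y).re := by
  have h0 := integrable_dipoleFourier φ x M S a
  have h1 := integrable_norm_mul_dipoleFourier φ x M S a
  have hB := ((contDiff_dipoleField φ x M S).differentiable one_ne_zero y).hasFDerivAt
  have h2 := (EuclideanSpace.proj (𝕜 := ℝ) a).hasFDerivAt.comp y hB
  have h3 := Complex.reCLM.hasFDerivAt.comp y
    ((contDiff_invFourier h0 h1).differentiable one_ne_zero y).hasFDerivAt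
  have h4 := congrArg (fun T : R3 →L[ℝ] ℝ => T (e i)) (h2.unique h3)
  have h5 := fderiv_invFourier h0 h1 y (e i)
  simp only [inner_e] at h5
  rw [← h5]
  exact h4

lemma integrable_I_mul_mul_dipoleFourier (i a : Fin 3) :
    Integrable fun k : R3 => Complex.I * (k i : ℂ) * dipoleFourier φ x M S a k := by
  have hm := measurable_dipoleFourier φ x M S a
  have hi := measurable_apply i
  refine (integrable_norm_mul_dipoleFourier φ x M S a).mono'
    (Measurable.aestronglyMeasurable (by fun_prop)) (Filter.Eventually.of_forall fun k => ?_)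
  rw [norm_mul, norm_mul, Complex.norm_I, one_mul, Complex.norm_real]
  exact mul_le_mul_of_nonneg_right (abs_apply_le k i) (norm_nonneg _)

lemma divergence_dipoleField (y : R3) : divergence (dipoleField φ x M S) y = 0 := by
  have h : (fun k : R3 => ∑ i, Complex.I * (k i : ℂ) * dipoleFourier φ x M S i k) =
      fun k => (0 : ℂ) * 0 := by
    funext k
    simp only [dipoleFourier, Finset.mul_sum]
    rw [Finset.sum_comm, zero_mul]
    refine Finset.sum_eq_zero fun j _ => ?_
    have h1 : ∑ i, ((k i : ℝ) : ℂ) * (transverseMatrix i j.2 k : ℂ) = 0 := by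
      exact_mod_cast sum_mul_transverseMatrix j.2 k
    rw [← mul_zero (Complex.I * (((M j.1 * S j.1 j.2 : ℝ) : ℂ) *
      Complex.exp (-(Complex.I * ((inner ℝ k (x j.1) : ℝ) : ℂ))) * (φ ‖k‖ : ℂ))), ← h1,
      Finset.mul_sum]
    refine Finset.sum_congr rfl fun i _ => ?_
    push_cast
    ring
  simp only [divergence, partialD_dipoleField]
  rw [← Complex.re_sum, ← invFourier_sum _ fun i _ =>
    integrable_I_mul_mul_dipoleFourier φ x M S i i, h, invFourier_const_mul, zero_mul,
    Complex.zero_re]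

end

section

variable (φ : 𝓢(ℝ, ℝ))

lemma integrable_ofReal_comp_norm : Integrable fun k : R3 => ((φ ‖k‖ : ℝ) : ℂ) := by
  refine (integrable_pow_mul_abs_norm φ 0).mono'
    (Complex.measurable_ofReal.comp (measurable_comp_norm φ)).aestronglyMeasurable
    (Filter.Eventually.of_forall fun k => ?_)
  simp

lemma integrable_norm_mul_comp_norm : Integrable fun k : R3 => ‖k‖ * ‖((φ ‖k‖ : ℝ) : ℂ)‖ := by
  simpa using integrable_pow_mul_abs_norm φ 1

lemma integrable_I_mul_mul_comp_norm (a : Fin 3) :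
    Integrable fun k : R3 => Complex.I * (k a : ℂ) * ((φ ‖k‖ : ℝ) : ℂ) := by
  have hm := measurable_comp_norm φ
  have hi := measurable_apply a
  refine (integrable_norm_mul_comp_norm φ).mono'
    (Measurable.aestronglyMeasurable (by fun_prop)) (Filter.Eventually.of_forall fun k => ?_)
  rw [norm_mul, norm_mul, Complex.norm_I, one_mul, Complex.norm_real]
  exact mul_le_mul_of_nonneg_right (abs_apply_le k a) (norm_nonneg _)

lemma gradient_rho_apply (y : R3) (a : Fin 3) : gradient (rho φ) y a =
    (invFourier (fun k => Complex.I * (k a : ℂ) * ((φ ‖k‖ : ℝ) : ℂ)) y).re := by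
  have h0 := integrable_ofReal_comp_norm φ
  have h1 := integrable_norm_mul_comp_norm φ
  have h2 : HasFDerivAt (rho φ) _ y := Complex.reCLM.hasFDerivAt.comp y
    ((contDiff_invFourier h0 h1).differentiable one_ne_zero y).hasFDerivAt
  have h3 := fderiv_invFourier h0 h1 y (e a)
  simp only [inner_e] at h3
  rw [← inner_e, gradient, InnerProductSpace.toDual_symm_apply, h2.fderiv, ← h3]
  rfl

lemma integrable_exp_mul {G : R3 → ℂ} (hG : Integrable G) (x : R3) :
    Integrable fun k => Complex.exp (-(Complex.I * ((inner ℝ k x : ℝ) : ℂ))) * G k := by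
  refine hG.bdd_mul (c := 1) (Continuous.aestronglyMeasurable (by fun_prop))
    (Filter.Eventually.of_forall fun k => ?_)
  rw [norm_exp_neg_I_mul]

variable (x : Fin P → R3) (M : Fin P → ℝ) (S : Fin P → R3)

/-- The curl of the transverse part of the magnetisation is the curl of the magnetisation itself,
i.e. a sum of terms `∇ρ × S`. -/
lemma partialD_dipoleField_sub (a b : Fin 3) (y : R3) :
    partialD (dipoleField φ x M S) a b y - partialD (dipoleField φ x M S) b a y =
      ∑ l, M l * (gradient (rho φ) (y - x l) a * S l b - gradient (rho φ) (y - x l) b * S l a) := by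
  have h : (fun k : R3 => Complex.I * (k a : ℂ) * dipoleFourier φ x M S b k -
      Complex.I * (k b : ℂ) * dipoleFourier φ x M S a k) =
      fun k => ∑ l, ((M l * S l b : ℝ) : ℂ) *
          (Complex.exp (-(Complex.I * ((inner ℝ k (x l) : ℝ) : ℂ))) *
            (Complex.I * (k a : ℂ) * ((φ ‖k‖ : ℝ) : ℂ))) -
        ∑ l, ((M l * S l a : ℝ) : ℂ) *
          (Complex.exp (-(Complex.I * ((inner ℝ k (x l) : ℝ) : ℂ))) *
            (Complex.I * (k b : ℂ) * ((φ ‖k‖ : ℝ) : ℂ))) := by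
    funext k
    simp only [dipoleFourier, Finset.mul_sum, Fintype.sum_prod_type, ← Finset.sum_sub_distrib]
    refine Finset.sum_congr rfl fun l _ => ?_
    have h1 : ∀ m, (k a : ℂ) * (transverseMatrix b m k : ℂ) -
        (k b : ℂ) * (transverseMatrix a m k : ℂ) =
          (k a : ℂ) * (if b = m then 1 else 0) - (k b : ℂ) * (if a = m then 1 else 0) := by
      intro m
      have h3 := congrArg (fun t : ℝ => (t : ℂ)) (mul_transverseMatrix_sub a b m k)
      simpa only [Complex.ofReal_sub, Complex.ofReal_mul, apply_ite Complex.ofReal,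
        Complex.ofReal_one, Complex.ofReal_zero] using h3
    have h2 : ∑ m, (S l m : ℂ) * ((k a : ℂ) * (if b = m then 1 else 0) -
        (k b : ℂ) * (if a = m then 1 else 0)) = (k a : ℂ) * S l b - (k b : ℂ) * S l a := by
      simp only [mul_sub, Finset.sum_sub_distrib, mul_ite, mul_one, mul_zero, Finset.sum_ite_eq,
        Finset.mem_univ, if_true]
      ring
    calc _ = ∑ m, (M l : ℂ) * Complex.exp (-(Complex.I * ((inner ℝ k (x l) : ℝ) : ℂ))) *
          Complex.I * (φ ‖k‖ : ℂ) * ((S l m : ℂ) * ((k a : ℂ) * (transverseMatrix b m k : ℂ) -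
            (k b : ℂ) * (transverseMatrix a m k : ℂ))) := by
          refine Finset.sum_congr rfl fun m _ => ?_
          push_cast
          ring
      _ = _ := by
          simp only [h1, ← Finset.mul_sum, h2]
          push_cast
          ring
  have hi := fun c l => integrable_exp_mul (integrable_I_mul_mul_comp_norm φ c) (x l)
  rw [partialD_dipoleField, partialD_dipoleField, ← Complex.sub_re,
    ← invFourier_sub (integrable_I_mul_mul_dipoleFourier φ x M S a b)
      (integrable_I_mul_mul_dipoleFourier φ x M S b a), h,
    invFourier_sub (integrable_finsetSum _ fun l _ => (hi a l).const_mul _)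
      (integrable_finsetSum _ fun l _ => (hi b l).const_mul _),
    invFourier_sum _ fun l _ => (hi a l).const_mul _,
    invFourier_sum _ fun l _ => (hi b l).const_mul _, ← Finset.sum_sub_distrib, Complex.re_sum]
  refine Finset.sum_congr rfl fun l _ => ?_
  rw [invFourier_const_mul, invFourier_const_mul, invFourier_translate, invFourier_translate,
    Complex.sub_re, Complex.re_ofReal_mul, Complex.re_ofReal_mul, ← gradient_rho_apply,
    ← gradient_rho_apply]
  ring

lemma curl_dipoleField (y : R3) : curl (dipoleField φ x M S) y = current φ x M S y := by
  have h : ∀ l : Fin P, ∀ a, (M l • cross (gradient (rho φ) (y - x l)) (S l)) a =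
      M l * cross (gradient (rho φ) (y - x l)) (S l) a := fun l a => rfl
  refine PiLp.ext fun a => ?_
  rw [current, WithLp.ofLp_sum, Finset.sum_apply]
  simp only [h]
  fin_cases a <;> simp [curl, partialD_dipoleField_sub, cross, cross_apply]

lemma isMagneticField_dipoleField : IsMagneticField (current φ x M S) (dipoleField φ x M S) where
  contDiff := contDiff_dipoleField φ x M S
  memLp := memLp_dipoleField φ x M S
  divergence_eq := divergence_dipoleField φ x M S
  curl_eq := curl_dipoleField φ x M S

/-- By the Plancherel theorem the field energy is a double sum over the dipoles, with the same
coefficients as the second order operator. -/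
lemma integral_norm_sq_dipoleField :
    ((∫ y, ‖dipoleField φ x M S y‖ ^ 2 : ℝ) : ℂ) =
      ∑ i : Fin P × Fin 3, ∑ j : Fin P × Fin 3,
        ((M i.1 * S i.1 i.2 * (M j.1 * S j.1 j.2) : ℝ) : ℂ) *
          transverseCoeff φ i.2 j.2 (x j.1 - x i.1) := by
  have h1 := fun a => invFourier_memLp_two (integrable_dipoleFourier φ x M S a)
    (memLp_dipoleFourier φ x M S a)
  have h2 := fun a => (memLp_two_iff_integrable_sq_norm (memLp_dipoleFourier φ x M S a).1).mp
    (memLp_dipoleFourier φ x M S a)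
  have h3 : ∫ y, ‖dipoleField φ x M S y‖ ^ 2 =
      ((2 * Real.pi) ^ 3)⁻¹ * ∫ k, ∑ a, ‖dipoleFourier φ x M S a k‖ ^ 2 := by
    simp only [norm_sq_dipoleField]
    rw [integral_finsetSum _ fun a _ => (memLp_two_iff_integrable_sq_norm (h1 a).1.1).mp (h1 a).1,
      integral_finsetSum _ fun a _ => h2 a, Finset.mul_sum]
    exact Finset.sum_congr rfl fun a _ => (h1 a).2
  have h4 : ∀ k, ((∑ a, ‖dipoleFourier φ x M S a k‖ ^ 2 : ℝ) : ℂ) =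
      ∑ i : Fin P × Fin 3, ∑ j : Fin P × Fin 3,
        ((M i.1 * S i.1 i.2 * (M j.1 * S j.1 j.2) : ℝ) : ℂ) * (((|φ ‖k‖| ^ 2 : ℝ) : ℂ) *
          Complex.exp (-(Complex.I * ((inner ℝ k (x j.1 - x i.1) : ℝ) : ℂ))) *
            (transverseMatrix i.2 j.2 k : ℂ)) := by
    intro k
    have h5 : ∀ a, ((‖dipoleFourier φ x M S a k‖ ^ 2 : ℝ) : ℂ) =
        starRingEnd ℂ (dipoleFourier φ x M S a k) * dipoleFourier φ x M S a k := fun a => by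
      rw [Complex.conj_mul']
      push_cast
      rfl
    rw [Complex.ofReal_sum]
    simp only [h5]
    simp only [dipoleFourier, map_sum, Finset.sum_mul_sum]
    rw [Finset.sum_comm]
    refine Finset.sum_congr rfl fun i _ => ?_
    rw [Finset.sum_comm]
    refine Finset.sum_congr rfl fun j _ => ?_
    have h6 : Complex.exp (-(Complex.I * ((inner ℝ k (x j.1 - x i.1) : ℝ) : ℂ))) =
        starRingEnd ℂ (Complex.exp (-(Complex.I * ((inner ℝ k (x i.1) : ℝ) : ℂ)))) *
          Complex.exp (-(Complex.I * ((inner ℝ k (x j.1) : ℝ) : ℂ))) := by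
      rw [← Complex.exp_conj, ← Complex.exp_add, inner_sub_right]
      congr 1
      simp
      ring
    rw [h6, ← sum_transverseMatrix_mul, sq_abs, Complex.ofReal_sum, Finset.mul_sum, Finset.mul_sum]
    refine Finset.sum_congr rfl fun a _ => ?_
    simp only [map_mul, Complex.conj_ofReal]
    push_cast
    ring
  rw [h3, Complex.ofReal_mul, ← integral_complex_ofReal]
  simp only [h4]
  have hi := fun i j : Fin P × Fin 3 => (integrable_transverseCoeff φ i.2 j.2
    (x j.1 - x i.1)).const_mul ((M i.1 * S i.1 i.2 * (M j.1 * S j.1 j.2) : ℝ) : ℂ)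
  rw [integral_finsetSum _ fun i _ => integrable_finsetSum _ fun j _ => hi i j, Finset.mul_sum]
  refine Finset.sum_congr rfl fun i _ => ?_
  rw [integral_finsetSum _ fun j _ => hi i j, Finset.mul_sum]
  refine Finset.sum_congr rfl fun j _ => ?_
  rw [integral_const_mul, Complex.ofReal_inv, mul_left_comm]
  rfl

end

end

/-! ### The energy of a product state -/

/-- The spins at two sites contribute to the second order energy of a product state as the two
classical spins do; the spin at a single site contributes the value of the Casimir operator
instead of the square of the classical spin. -/
lemma sum_transverseCoeff_mul_inner_siteOp {P d : ℕ} {u : Fin 3 → su2}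
    (hu : IsSpinTriple fun j => (u j : Matrix (Fin 2) (Fin 2) ℂ)) (φ : 𝓢(ℝ, ℝ)) (x : Fin P → R3)
    {V : Fin P → SpinSpace d} (hV : ∀ l, ‖V l‖ = 1) (hS : ∀ l, ∑ j, hopf d u (V l) j ^ 2 = 1)
    (l l' : Fin P) :
    ∑ m, ∑ m', transverseCoeff φ m m' (x l' - x l) *
        inner ℂ (Matrix.toEuclideanLin (siteOp l (sigma d u m))
          (Matrix.toEuclideanLin (siteOp l' (sigma d u m')) (productState V))) (productState V) =
      (∑ m, ∑ m', ((hopf d u (V l) m * hopf d u (V l') m' : ℝ) : ℂ) *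
        transverseCoeff φ m m' (x l' - x l)) +
        if l = l' then ((d * (d + 2) - 1 : ℝ) : ℂ) * transverseCoeff φ 0 0 0 else 0 := by
  split_ifs with h
  · subst h
    have hS' : ∑ m, ((hopf d u (V l) m : ℝ) : ℂ) * hopf d u (V l) m = 1 := by
      have := hS l
      simp only [sq] at this
      exact_mod_cast this
    have hQ := sum_inner_sigma_mul_self hu (hV l)
    have hT := transverseCoeff_zero φ
    generalize transverseCoeff φ 0 0 0 = T at hT ⊢
    simp only [inner_siteOp_siteOp_self l _ _ hV, sub_self, hT, ite_mul,
      mul_ite, zero_mul, mul_zero, Finset.sum_ite_eq, Finset.mem_univ, if_true,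
      ← Finset.mul_sum, ← Finset.sum_mul, hQ, Complex.ofReal_mul, hS']
    push_cast
    ring
  · rw [add_zero]
    refine Finset.sum_congr rfl fun m _ => Finset.sum_congr rfl fun m' _ => ?_
    rw [inner_siteOp_siteOp_of_ne h _ _ hV, ← coe_hopf, ← coe_hopf, Complex.ofReal_mul, mul_comm]

lemma inner_secondOrderOp {P d : ℕ} {u : Fin 3 → su2}
    (hu : IsSpinTriple fun j => (u j : Matrix (Fin 2) (Fin 2) ℂ)) (φ : 𝓢(ℝ, ℝ)) (x : Fin P → R3)
    (M : Fin P → ℝ) {V : Fin P → SpinSpace d} (hV : ∀ l, ‖V l‖ = 1)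
    (hS : ∀ l, ∑ j, hopf d u (V l) j ^ 2 = 1)
    (hX : productState V ∈ (secondOrderOp d u φ x M).domain) :
    inner ℂ (secondOrderOp d u φ x M ⟨productState V, hX⟩) (productState V) =
      -(1 / 2 : ℂ) * ((∫ y, ‖dipoleField φ x M (fun l => hopf d u (V l)) y‖ ^ 2 : ℝ) : ℂ) -
        (1 / 2 : ℂ) * ((d * (d + 2) - 1 : ℝ) : ℂ) * transverseCoeff φ 0 0 0 *
          ((∑ l, M l ^ 2 : ℝ) : ℂ) := by
  set Q : Fin P → Fin P → Fin 3 → Fin 3 → ℂ := fun l l' m m' =>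
    inner ℂ (Matrix.toEuclideanLin (siteOp l (sigma d u m))
      (Matrix.toEuclideanLin (siteOp l' (sigma d u m')) (productState V))) (productState V) with hQ
  have key := sum_transverseCoeff_mul_inner_siteOp hu φ x hV hS
  -- Both sides become double sums over the sites, which are compared with `key`.
  have h1 : inner ℂ (secondOrderOp d u φ x M ⟨productState V, hX⟩) (productState V) =
      -∑ l, ∑ l', (M l * M l' / 2 : ℂ) * ∑ m, ∑ m', transverseCoeff φ m m' (x l' - x l) *
        Q l l' m m' := by
    rw [mem_graph_apply_eq (mem_graph_secondOrderOp d u φ x M (productState V)) hX,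
      inner_neg_left, sum_inner, Fintype.sum_prod_type]
    congr 1
    refine Finset.sum_congr rfl fun l _ => ?_
    simp only [sum_inner, Fintype.sum_prod_type]
    rw [Finset.sum_comm]
    refine Finset.sum_congr rfl fun l' _ => ?_
    rw [Finset.mul_sum]
    refine Finset.sum_congr rfl fun m _ => ?_
    rw [Finset.mul_sum]
    refine Finset.sum_congr rfl fun m' _ => ?_
    rw [inner_smul_left, map_mul, conj_transverseCoeff]
    simp only [hQ, map_div₀, map_mul, Complex.conj_ofReal, map_ofNat, Complex.ofReal_mul]
    ring
  have h2 : ((∫ y, ‖dipoleField φ x M (fun l => hopf d u (V l)) y‖ ^ 2 : ℝ) : ℂ) =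
      ∑ l, ∑ l', (M l * M l' : ℂ) * ∑ m, ∑ m',
        ((hopf d u (V l) m * hopf d u (V l') m' : ℝ) : ℂ) *
          transverseCoeff φ m m' (x l' - x l) := by
    rw [integral_norm_sq_dipoleField, Fintype.sum_prod_type]
    refine Finset.sum_congr rfl fun l _ => ?_
    simp only [Fintype.sum_prod_type]
    rw [Finset.sum_comm]
    refine Finset.sum_congr rfl fun l' _ => ?_
    rw [Finset.mul_sum]
    refine Finset.sum_congr rfl fun m _ => ?_
    rw [Finset.mul_sum]
    refine Finset.sum_congr rfl fun m' _ => ?_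
    push_cast
    ring
  have h3 : ∑ l, ∑ l', (M l * M l' / 2 : ℂ) *
      (if l = l' then ((d * (d + 2) - 1 : ℝ) : ℂ) * transverseCoeff φ 0 0 0 else 0) =
      (1 / 2 : ℂ) * ((d * (d + 2) - 1 : ℝ) : ℂ) * transverseCoeff φ 0 0 0 *
          ((∑ l, M l ^ 2 : ℝ) : ℂ) := by
    simp only [mul_ite, mul_zero, Finset.sum_ite_eq, Finset.mem_univ, if_true]
    rw [Complex.ofReal_sum, Finset.mul_sum]
    refine Finset.sum_congr rfl fun l _ => ?_
    push_cast
    ring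
  rw [h1, h2, ← h3]
  simp only [hQ, key, mul_add, Finset.sum_add_distrib]
  rw [Finset.mul_sum, neg_add, ← sub_eq_add_neg, ← Finset.sum_neg_distrib]
  congr 1
  refine Finset.sum_congr rfl fun l _ => ?_
  rw [Finset.mul_sum, ← Finset.sum_neg_distrib]
  refine Finset.sum_congr rfl fun l' _ => ?_
  ring

end

end SpinQED

theorem theorem2p6
    (s : ℝ) (d : ℕ) (hd : 1 ≤ d) (hs : s = (d : ℝ) / 2)
    (u : Module.Basis (Fin 3) ℝ SpinQED.su2)
    (hu : ∀ j : Fin 3, ⁅(u j : Matrix (Fin 2) (Fin 2) ℂ), (u (j + 1) : Matrix (Fin 2) (Fin 2) ℂ)⁆ =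
      (2 : ℝ) • (u (j + 2) : Matrix (Fin 2) (Fin 2) ℂ))
    (φ : SchwartzMap ℝ ℝ) (hφ : ∀ t, φ (-t) = φ t)
    (P : ℕ) (x : Fin P → SpinQED.R3) (M : Fin P → ℝ)
    (X₀ : SpinQED.SpinSpace d) (hX₀ : ‖X₀‖ = 1)
    (hX₀' : ∑ j, inner ℂ (Matrix.toEuclideanLin (SpinQED.sigma d u j) X₀) X₀ ^ 2 = 1)
    (V : Fin P → SpinQED.SpinSpace d) (hV : ∀ l, V l ∈ SpinQED.orbit d X₀) :
    ∃ hX : SpinQED.productState V ∈ (SpinQED.secondOrderOp d u φ x M).domain,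
      (∃! B : SpinQED.R3 → SpinQED.R3,
        SpinQED.IsMagneticField (SpinQED.current φ x M fun l => SpinQED.hopf d u (V l)) B) ∧
      ∀ B : SpinQED.R3 → SpinQED.R3,
        SpinQED.IsMagneticField (SpinQED.current φ x M fun l => SpinQED.hopf d u (V l)) B →
        inner ℂ (SpinQED.secondOrderOp d u φ x M ⟨SpinQED.productState V, hX⟩)
            (SpinQED.productState V) =
          -(1 / 2 : ℂ) * ((∫ y, ‖B y‖ ^ 2 : ℝ) : ℂ)
            - ((2 * s * (s + 1) - 1 / 2 : ℝ) : ℂ) * SpinQED.transverseCoeff φ 0 0 0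
              * ((∑ l, M l ^ 2 : ℝ) : ℂ) := by
  have hT := SpinQED.isSpinTriple_basis u hu
  have hnorm := fun l => SpinQED.norm_eq_one_of_mem_orbit hX₀ (hV l)
  have hS := fun l => SpinQED.sum_hopf_sq hT hX₀' (hV l)
  have hB := SpinQED.isMagneticField_dipoleField φ x M fun l => SpinQED.hopf d u (V l)
  have hX := LinearPMap.mem_domain_of_mem_graph
    (SpinQED.mem_graph_secondOrderOp d u φ x M (SpinQED.productState V))
  refine ⟨hX, ⟨_, hB, fun B h => h.unique hB⟩, fun B h => ?_⟩
  rw [h.unique hB, SpinQED.inner_secondOrderOp hT φ x M hnorm hS hX, hs]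
  push_cast
  ring
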